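/- Let $d,m\ge 2$ be integers. For $n\ge 1$ let $Q(\mathbb R^n)$ be the set of invertible real $n\times n$ matrices all of whose (complex) eigenvalues have positive real parts, and let $M(\mathbb R^n)$ be the set of real $n\times n$ matrices all of whose eigenvalues have nonnegative real parts and for which every eigenvalue with zero real part is a simple root of the minimal polynomial. For $r>0$ and a square matrix $A$ put $r^A=\exp((\ln r)A)$, and let $\stackrel{d}{=}$ denote equality of all finite-dimensional distributions. Let $E\in Q(\mathbb R^d)$ and let $X=\{X(t),\,t\in\mathbb R^d\}$ be a random field with values in $\mathbb R^m$ such that - $X$ is stochastically continuous, i.e. $X(s)\to X(t)$ in probability as $s\to t$, for every $t\in\mathbb R^d$; - $X$ is proper, i.e. for each $t\neq 0$ the support of the distribution of $X(t)$ is not contained in any (affine) hyperplane of $\mathbb R^m$; - $X$ is wide-sense operator-self-similar with time-variable scaling exponent $E$, i.e. for every $r>0$ there exist a (non-random) $m\times m$ matrix $B(r)$ and a (non-random) function $a_r:\mathbb R^d\to\mathbb R^m$ with $\{X(r^Et),\,t\in\mathbb R^d\}\stackrel{d}{=}\{B(r)X(t)+a_r(t),\,t\in\mathbb R^d\}$.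 Then there exist a matrix $D\in M(\mathbb R^m)$ and a function $(r,t)\mapsto b_r(t)$ from $(0,\infty)\times\mathbb R^d$ to $\mathbb R^m$, continuous at every point of $(0,\infty)\times\mathbb R^d$, such that for all $r>0$ $$\{X(r^Et),\,t\in\mathbb R^d\}\stackrel{d}{=}\{r^DX(t)+b_r(t),\,t\in\mathbb R^d\}.$$ Furthermore, there is a constant vector $a\in\mathbb R^m$ with $X(0)=a$ a.s. if and only if $D\in Q(\mathbb R^m)$. In this latter case, if one defines $b_0(t)=a$ for all $t\in\mathbb R^d$, then the function $(r,t)\mapsto b_r(t)$ is continuous on $[0,\infty)\times\mathbb R^d$. -/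

import Mathlib

open MeasureTheory ProbabilityTheory Topology Filter

/-- The linear action of a real `n × n` matrix on the Euclidean space `ℝⁿ`. -/
noncomputable def matAct {n : ℕ} (A : Matrix (Fin n) (Fin n) ℝ)
    (x : EuclideanSpace ℝ (Fin n)) : EuclideanSpace ℝ (Fin n) :=
  Matrix.toEuclideanCLM (n := Fin n) (𝕜 := ℝ) A x

/-- The operator power `r ^ A = exp ((log r) A)`, used for `r > 0`. -/
noncomputable def opPow {n : ℕ} (r : ℝ) (A : Matrix (Fin n) (Fin n) ℝ) :
    Matrix (Fin n) (Fin n) ℝ :=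
  NormedSpace.exp (Real.log r • A)

/-- A real matrix regarded as a complex matrix. -/
noncomputable def complexify {n : ℕ} (A : Matrix (Fin n) (Fin n) ℝ) :
    Matrix (Fin n) (Fin n) ℂ :=
  A.map Complex.ofReal

/-- `z` is a (possibly complex) eigenvalue of the real matrix `A`. -/
def IsComplexEigenvalue {n : ℕ} (A : Matrix (Fin n) (Fin n) ℝ) (z : ℂ) : Prop :=
  Module.End.HasEigenvalue (Matrix.toLin' (complexify A)) z

/-- `Q(ℝⁿ)`: the invertible matrices all of whose eigenvalues have positive real parts. -/
def classQ (n : ℕ) : Set (Matrix (Fin n) (Fin n) ℝ) :=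
  {A | IsUnit A ∧ ∀ z : ℂ, IsComplexEigenvalue A z → 0 < z.re}

/-- `M(ℝⁿ)`: the matrices all of whose eigenvalues have nonnegative real parts and for which
every eigenvalue with zero real part is a simple root of the minimal polynomial. -/
def classM (n : ℕ) : Set (Matrix (Fin n) (Fin n) ℝ) :=
  {A | (∀ z : ℂ, IsComplexEigenvalue A z → 0 ≤ z.re) ∧
    ∀ z : ℂ, IsComplexEigenvalue A z → z.re = 0 →
      (minpoly ℂ (complexify A)).rootMultiplicity z = 1}

/-- A measure on `ℝᵐ` is full if its support is not contained in any (affine) hyperplane. -/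
def IsFull {m : ℕ} (μ : Measure (EuclideanSpace ℝ (Fin m))) : Prop :=
  ∀ (v : EuclideanSpace ℝ (Fin m)) (c : ℝ), v ≠ 0 → ¬ μ.support ⊆ {x | inner ℝ v x = c}

/-- Equality of all finite-dimensional distributions of two random fields. -/
def EqFDD {T Ω F : Type*} [MeasurableSpace Ω] [MeasurableSpace F] (P : Measure Ω)
    (X Y : T → Ω → F) : Prop :=
  ∀ I : Finset T, IdentDistrib (fun ω (t : I) => X t ω) (fun ω (t : I) => Y t ω) P P

/-- Stochastic continuity: `X s → X t` in probability as `s → t`, for every `t`. -/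
def StochasticallyContinuous {d m : ℕ} {Ω : Type*} [MeasurableSpace Ω] (P : Measure Ω)
    (X : EuclideanSpace ℝ (Fin d) → Ω → EuclideanSpace ℝ (Fin m)) : Prop :=
  ∀ t, TendstoInMeasure P X (𝓝 t) (X t)

/-- A random field is proper if the distribution of `X t` is full for every `t ≠ 0`. -/
def IsProperField {d m : ℕ} {Ω : Type*} [MeasurableSpace Ω] (P : Measure Ω)
    (X : EuclideanSpace ℝ (Fin d) → Ω → EuclideanSpace ℝ (Fin m)) : Prop :=
  ∀ t, t ≠ 0 → IsFull (P.map (X t))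

/-- `{X(r^E t), t ∈ ℝᵈ}` has the same finite-dimensional distributions as
`{B X(t) + a(t), t ∈ ℝᵈ}`. -/
def ScalesBy {d m : ℕ} {Ω : Type*} [MeasurableSpace Ω] (P : Measure Ω)
    (X : EuclideanSpace ℝ (Fin d) → Ω → EuclideanSpace ℝ (Fin m))
    (E : Matrix (Fin d) (Fin d) ℝ) (r : ℝ) (B : Matrix (Fin m) (Fin m) ℝ)
    (a : EuclideanSpace ℝ (Fin d) → EuclideanSpace ℝ (Fin m)) : Prop :=
  EqFDD P (fun t => X (matAct (opPow r E) t)) (fun t ω => matAct B (X t ω) + a t)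

/-- Wide-sense operator-self-similarity with time-variable scaling exponent `E`. -/
def IsWOSS {d m : ℕ} {Ω : Type*} [MeasurableSpace Ω] (P : Measure Ω)
    (X : EuclideanSpace ℝ (Fin d) → Ω → EuclideanSpace ℝ (Fin m))
    (E : Matrix (Fin d) (Fin d) ℝ) : Prop :=
  ∀ r : ℝ, 0 < r → ∃ (B : Matrix (Fin m) (Fin m) ℝ)
    (a : EuclideanSpace ℝ (Fin d) → EuclideanSpace ℝ (Fin m)), ScalesBy P X E r B a

/-!
The linear parts of the affine maps which rescale the law of `X` form a group over the scaling
parameter: if `S s` denotes the set of linear maps `A` such that `X (exp (s E) t)` and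
`A (X t) + a t` have the same finite-dimensional distributions for some shift `a`, then
`S s * S t ⊆ S (s + t)`, the elements of `S s` are invertible with inverses in `S (-s)`, and
sequences `A n ∈ S (s n)` with `s n` bounded are relatively compact. Compactness is the convergence
of types theorem. It is proved after passing to the symmetrization
`(ω, ω') ↦ X t ω - X t ω'` (`symmetrize`), which removes the shifts and turns fullness into the
statement that the vector lies in no hyperplane through the origin
(`IsLinearlyFull.exists_subseq_tendsto`). The shifts then converge by
`exists_tendsto_of_identDistrib_add`, so the sets `S s` have closed graph
(`isProperFibration_scalingSet`).

The exponent `D` is a one-parameter subgroup `s ↦ exp (s D) ∈ S s`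
(`IsProperFibration.exists_forall_exp_smul_mem`). Instead of the structure theory of closed
subgroups of Lie groups, the proof chooses in `S s`, for small `s > 0`, an element nearest to the
identity; minimality forces the distance to be of order `s`, and a limit of difference quotients is
the generator. Continuity of the shifts in `(r, t)` is again convergence of types
(`tendsto_shift`).

The spectral statements come from `s → -∞`. The eigenvalues of `E` have positive real part, so
`exp (s E) t → 0` and the symmetrization of `exp (s D) (X t)` converges in law to that of `X 0`.
Fullness of `X t` then makes `exp (s D)` converge along a sequence, which rules out eigenvalues of
negative real part and nontrivial Jordan blocks on the imaginary axis; the limit is zero when `X 0`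
is constant, and then all real parts are positive. Conversely, if `exp (s D) → 0`, then the relation
at `t = 0` shows that the symmetrization of `X 0` vanishes.
-/

/-! ### One-parameter subgroups of closed matrix groups -/

section OneParameter

variable {𝔸 : Type*} [NormedRing 𝔸]

lemma norm_pow_sub_pow_le {a b : 𝔸} [NormOneClass 𝔸] {M : ℝ} (hM : 1 ≤ M) (ha : ‖a‖ ≤ M)
    (hb : ‖b‖ ≤ M) (k : ℕ) : ‖a ^ k - b ^ k‖ ≤ k * M ^ k * ‖a - b‖ := by
  induction k with
  | zero => simp
  | succ k ih =>
    have h0 : 0 ≤ M := by linarith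
    have e : a ^ (k + 1) - b ^ (k + 1) = a ^ k * (a - b) + (a ^ k - b ^ k) * b := by
      rw [pow_succ, pow_succ]; noncomm_ring
    rw [e]
    have h1 : ‖a ^ k * (a - b)‖ ≤ M ^ k * ‖a - b‖ :=
      (norm_mul_le _ _).trans (by gcongr; exact (norm_pow_le a k).trans (by gcongr))
    have h2 : ‖(a ^ k - b ^ k) * b‖ ≤ (k * M ^ k * ‖a - b‖) * M :=
      (norm_mul_le _ _).trans (by gcongr)
    have h3 : M ^ k * ‖a - b‖ ≤ M ^ (k + 1) * ‖a - b‖ := by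
      gcongr
      exact Nat.le_succ k
    calc _ ≤ _ := norm_add_le _ _
      _ ≤ M ^ (k + 1) * ‖a - b‖ + (k * M ^ k * ‖a - b‖) * M := by linarith
      _ = _ := by push_cast; ring

/-- Sequences with the same difference quotient at `1`, at scale `1 / k n`, have asymptotically
equal `k n`-th powers. -/
lemma tendsto_pow_sub_pow_of_tendsto_smul [NormedAlgebra ℝ 𝔸] [NormOneClass 𝔸] {A B : ℕ → 𝔸} {k : ℕ → ℕ} {Z : 𝔸}
    (hA : Tendsto (fun n => (k n : ℝ) • (A n - 1)) atTop (𝓝 Z))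
    (hB : Tendsto (fun n => (k n : ℝ) • (B n - 1)) atTop (𝓝 Z)) :
    Tendsto (fun n => A n ^ k n - B n ^ k n) atTop (𝓝 0) := by
  have hAB : Tendsto (fun n => (k n : ℝ) * ‖A n - B n‖) atTop (𝓝 0) := by
    have := (hA.sub hB).norm
    simp only [sub_self, norm_zero] at this
    refine this.congr fun n => ?_
    rw [← smul_sub, sub_sub_sub_cancel_right, norm_smul, Real.norm_natCast]
  set C : ℝ := ‖Z‖ + 1
  have hC : 0 ≤ C := by positivity
  -- both sequences are `1 + O(1 / k n)`, so that their `k n`-th powers stay bounded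
  have key : ∀ {A : ℕ → 𝔸}, Tendsto (fun n => (k n : ℝ) • (A n - 1)) atTop (𝓝 Z) →
      ∀ᶠ n in atTop, k n ≠ 0 → ‖A n‖ ≤ Real.exp (C / k n) := by
    intro A hA
    filter_upwards [hA.norm.eventually_lt_const (show ‖Z‖ < C by simp [C])] with n hn hk
    have hk' : (0 : ℝ) < k n := by positivity
    rw [norm_smul, Real.norm_natCast] at hn
    have h1 : ‖A n - 1‖ ≤ C / k n := by
      rw [le_div_iff₀ hk']; linarith
    calc ‖A n‖ = ‖(A n - 1) + 1‖ := by simp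
      _ ≤ ‖A n - 1‖ + ‖(1 : 𝔸)‖ := norm_add_le _ _
      _ ≤ C / k n + 1 := by rw [norm_one]; linarith
      _ ≤ _ := Real.add_one_le_exp _
  rw [tendsto_zero_iff_norm_tendsto_zero]
  have hlim : Tendsto (fun n => Real.exp C * ((k n : ℝ) * ‖A n - B n‖)) atTop (𝓝 0) := by
    simpa using hAB.const_mul (Real.exp C)
  refine squeeze_zero' (Eventually.of_forall fun n => norm_nonneg _) ?_ hlim
  filter_upwards [key hA, key hB] with n h1 h2
  rcases eq_or_ne (k n) 0 with hk | hk
  · simp [hk]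
  · have hk' : (0 : ℝ) < k n := by positivity
    have h3 : Real.exp (C / k n) ^ k n = Real.exp C := by
      rw [← Real.exp_nat_mul]; congr 1; field_simp
    have := norm_pow_sub_pow_le (Real.one_le_exp (by positivity)) (h1 hk) (h2 hk) (k n)
    rw [h3] at this
    linarith

/-- The derivative of `exp` at the origin, along a sequence of reals tending to zero. -/
lemma tendsto_inv_smul_exp_smul_sub_one [NormedAlgebra ℝ 𝔸] [CompleteSpace 𝔸] (Y : 𝔸) {ι : Type*} {l : Filter ι}
    {ε : ι → ℝ} (hε : Tendsto ε l (𝓝 0)) (hε0 : ∀ᶠ n in l, ε n ≠ 0) :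
    Tendsto (fun n => (ε n)⁻¹ • (NormedSpace.exp (ε n • Y) - 1)) l (𝓝 Y) := by
  have h := (hasDerivAt_exp_smul_const (𝕂 := ℝ) Y (0 : ℝ)).tendsto_slope
  simp only [zero_smul, NormedSpace.exp_zero, one_mul] at h
  have h2 : Tendsto ε l (𝓝[≠] 0) := tendsto_nhdsWithin_iff.2 ⟨hε, hε0⟩
  refine (h.comp h2).congr fun n => ?_
  simp [slope, NormedSpace.exp_zero]

/-- A form of `(1 + Z / k) ^ k → exp Z` in a Banach algebra. -/
lemma tendsto_pow_exp_of_tendsto_smul [NormedAlgebra ℝ 𝔸] [NormOneClass 𝔸] [CompleteSpace 𝔸]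
    {A : ℕ → 𝔸} {k : ℕ → ℕ} {Z : 𝔸} (hk : Tendsto k atTop atTop)
    (hA : Tendsto (fun n => (k n : ℝ) • (A n - 1)) atTop (𝓝 Z)) :
    Tendsto (fun n => A n ^ k n) atTop (𝓝 (NormedSpace.exp Z)) := by
  have hk' : Tendsto (fun n => (k n : ℝ)) atTop atTop := tendsto_natCast_atTop_atTop.comp hk
  have h := tendsto_inv_smul_exp_smul_sub_one Z (tendsto_inv_atTop_zero.comp hk')
    ((hk.eventually_ne_atTop 0).mono fun n hn => by simpa using hn)
  simp only [Function.comp_apply, inv_inv] at h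
  have h2 := tendsto_pow_sub_pow_of_tendsto_smul hA h
  rw [← tendsto_sub_nhds_zero_iff]
  refine h2.congr' ?_
  filter_upwards [hk.eventually_ne_atTop 0] with n hn
  let : NormedAlgebra ℚ 𝔸 := NormedAlgebra.restrictScalars ℚ ℝ 𝔸
  rw [← NormedSpace.exp_nsmul, ← Nat.cast_smul_eq_nsmul ℝ, smul_smul, mul_inv_cancel₀ (by positivity),
    one_smul]

/-- A family of sets `S s` in a normed algebra, indexed by the additive group `ℝ`, whose graph
`{(s, A) | A ∈ S s}` is a closed subgroup of `ℝ × 𝔸ˣ` mapping properly onto `ℝ`. Closedness and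
properness are encoded together as sequential compactness over convergent parameters. -/
structure IsProperFibration (S : ℝ → Set 𝔸) : Prop where
  nonempty : ∀ s, (S s).Nonempty
  mul_mem : ∀ {s t A B}, A ∈ S s → B ∈ S t → A * B ∈ S (s + t)
  exists_inv : ∀ {s A}, A ∈ S s → ∃ B ∈ S (-s), A * B = 1 ∧ B * A = 1
  exists_tendsto : ∀ {s : ℕ → ℝ} {A : ℕ → 𝔸} {s₀ : ℝ}, Tendsto s atTop (𝓝 s₀) →
    (∀ n, A n ∈ S (s n)) →
    ∃ A₀ ∈ S s₀, ∃ φ : ℕ → ℕ, StrictMono φ ∧ Tendsto (A ∘ φ) atTop (𝓝 A₀)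

namespace IsProperFibration

variable {S : ℝ → Set 𝔸}

lemma one_mem (hS : IsProperFibration S) : (1 : 𝔸) ∈ S 0 := by
  obtain ⟨A, hA⟩ := hS.nonempty 0
  obtain ⟨B, hB, h1, -⟩ := hS.exists_inv hA
  have := hS.mul_mem hA hB
  rwa [h1, add_neg_cancel] at this

lemma pow_mem (hS : IsProperFibration S) {s : ℝ} {A : 𝔸} (hA : A ∈ S s) (k : ℕ) :
    A ^ k ∈ S (k * s) := by
  induction k with
  | zero => simpa using hS.one_mem
  | succ k ih =>
    rw [pow_succ]
    convert hS.mul_mem ih hA using 2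
    push_cast; ring

lemma mem_of_tendsto (hS : IsProperFibration S) {s : ℕ → ℝ} {A : ℕ → 𝔸} {s₀ : ℝ} {A₀ : 𝔸}
    (hs : Tendsto s atTop (𝓝 s₀)) (hA : Tendsto A atTop (𝓝 A₀)) (h : ∀ n, A n ∈ S (s n)) :
    A₀ ∈ S s₀ := by
  obtain ⟨A₁, h1, φ, hφ, h2⟩ := hS.exists_tendsto hs h
  rwa [tendsto_nhds_unique (hA.comp hφ.tendsto_atTop) h2]

lemma isCompact (hS : IsProperFibration S) (s : ℝ) : IsCompact (S s) := by
  refine IsSeqCompact.isCompact fun A hA => ?_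
  obtain ⟨A₀, h1, φ, hφ, h2⟩ := hS.exists_tendsto (tendsto_const_nhds (x := s)) hA
  exact ⟨A₀, h1, φ, hφ, h2⟩

/-- A tangent vector `Y` at `1` to the graph of `S`, obtained as a limit of difference quotients,
generates a one-parameter subgroup lying in that graph: powers of the elements `A n` converge to
`exp (t • Y)`. -/
lemma exp_smul_mem_of_tendsto [NormedAlgebra ℝ 𝔸] [NormOneClass 𝔸] [CompleteSpace 𝔸]
    (hS : IsProperFibration S)
    {s ε : ℕ → ℝ} {A : ℕ → 𝔸} {σ : ℝ} {Y : 𝔸} (hA : ∀ n, A n ∈ S (s n)) (hε : ∀ n, 0 < ε n)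
    (hε0 : Tendsto ε atTop (𝓝 0)) (hs : Tendsto (fun n => s n / ε n) atTop (𝓝 σ))
    (hY : Tendsto (fun n => (ε n)⁻¹ • (A n - 1)) atTop (𝓝 Y)) (t : ℝ) :
    NormedSpace.exp (t • Y) ∈ S (t * σ) := by
  have hpos : ∀ t : ℝ, 0 < t → NormedSpace.exp (t • Y) ∈ S (t * σ) := by
    intro t ht
    have hinv : Tendsto (fun n => (ε n)⁻¹) atTop atTop :=
      (tendsto_nhdsWithin_iff.2 ⟨hε0, Eventually.of_forall hε⟩).inv_tendsto_nhdsGT_zero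
    have h1 : Tendsto (fun n => (⌊t * (ε n)⁻¹⌋₊ : ℝ) * ε n) atTop (𝓝 t) := by
      have := (tendsto_nat_floor_mul_div_atTop (R := ℝ) ht.le).comp hinv
      refine this.congr fun n => ?_
      simp [div_eq_mul_inv]
    have hk : Tendsto (fun n => ⌊t * (ε n)⁻¹⌋₊) atTop atTop :=
      tendsto_nat_floor_atTop.comp (hinv.const_mul_atTop ht)
    refine hS.mem_of_tendsto (s := fun n => (⌊t * (ε n)⁻¹⌋₊ : ℝ) * s n)
      (A := fun n => A n ^ ⌊t * (ε n)⁻¹⌋₊) ?_ (tendsto_pow_exp_of_tendsto_smul hk ?_)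
      (fun n => hS.pow_mem (hA n) _)
    · refine (h1.mul hs).congr fun n => ?_
      have := (hε n).ne'
      field_simp
    · refine (h1.smul hY).congr fun n => ?_
      rw [smul_smul, mul_assoc, mul_inv_cancel₀ (hε n).ne', mul_one]
  rcases lt_trichotomy t 0 with ht | rfl | ht
  · obtain ⟨B, hB, h1, h2⟩ := hS.exists_inv (hpos (-t) (by linarith))
    let : NormedAlgebra ℚ 𝔸 := NormedAlgebra.restrictScalars ℚ ℝ 𝔸
    have h3 : NormedSpace.exp (t • Y) * NormedSpace.exp (-t • Y) = 1 := by
      rw [← NormedSpace.exp_add_of_commute (((Commute.refl Y).smul_left _).smul_right _),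
        ← add_smul]
      simp
    have h4 : NormedSpace.exp (t • Y) = B := by
      calc _ = NormedSpace.exp (t • Y) * (NormedSpace.exp (-t • Y) * B) := by rw [h1, mul_one]
        _ = B := by rw [← mul_assoc, h3, one_mul]
    rw [h4]
    simpa using hB
  · simpa using hS.one_mem
  · exact hpos t ht

/-- There is a continuous one-parameter group selecting an element of each `S s`. The fibres over
small `s > 0` contain elements nearest to `1`. If their distance to `1` is `O(s)`, a limit of
difference quotients is the generator. Otherwise, rescaling by the distance yields a unit vector
`Y` tangent to `S 0`, and multiplication by `exp (-ε • Y)` moves such an element nearer to `1`. -/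
theorem exists_forall_exp_smul_mem [NormedAlgebra ℝ 𝔸] [NormOneClass 𝔸] [FiniteDimensional ℝ 𝔸]
    (hS : IsProperFibration S) : ∃ D : 𝔸, ∀ s : ℝ, NormedSpace.exp (s • D) ∈ S s := by
  have : CompleteSpace 𝔸 := FiniteDimensional.complete ℝ 𝔸
  have : ProperSpace 𝔸 := FiniteDimensional.proper ℝ 𝔸
  let : NormedAlgebra ℚ 𝔸 := NormedAlgebra.restrictScalars ℚ ℝ 𝔸
  have hmin : ∀ s, ∃ A ∈ S s, ∀ B ∈ S s, ‖A - 1‖ ≤ ‖B - 1‖ := fun s =>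
    (hS.isCompact s).exists_isMinOn (f := fun A => ‖A - 1‖) (hS.nonempty s)
      (continuous_id.sub continuous_const).norm.continuousOn
  choose A hA hAmin using hmin
  -- the nearest elements converge to `1` along a sequence of indices
  obtain ⟨s, hs, hs0, hA1⟩ : ∃ s : ℕ → ℝ, (∀ n, 0 < s n) ∧ Tendsto s atTop (𝓝 0) ∧
      Tendsto (fun n => ‖A (s n) - 1‖) atTop (𝓝 0) := by
    have ht := tendsto_one_div_add_atTop_nhds_zero_nat (𝕜 := ℝ)
    obtain ⟨K, hK, φ, hφ, h⟩ := hS.exists_tendsto ht (fun n => hA (1 / ((n : ℝ) + 1)))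
    obtain ⟨K', hK', h1, -⟩ := hS.exists_inv hK
    refine ⟨fun n => 1 / ((φ n : ℝ) + 1), fun n => by positivity, ht.comp hφ.tendsto_atTop, ?_⟩
    have h2 : Tendsto (fun n => ‖A (1 / ((φ n : ℝ) + 1)) * K' - 1‖) atTop (𝓝 0) := by
      have := ((h.mul_const K').sub_const 1).norm
      simpa [h1] using this
    refine squeeze_zero (fun n => norm_nonneg _) (fun n => hAmin _ _ ?_) h2
    simpa using hS.mul_mem (hA _) hK'
  by_cases hC : ∃ C : ℝ, ∃ᶠ n in atTop, ‖A (s n) - 1‖ ≤ C * s n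
  · obtain ⟨C, hC⟩ := hC
    obtain ⟨ψ, hψ, hψC⟩ := extraction_of_frequently_atTop hC
    obtain ⟨D, -, φ, hφ, hD⟩ := tendsto_subseq_of_bounded (Metric.isBounded_closedBall (x := (0 : 𝔸))
      (r := C)) (x := fun n => (s (ψ n))⁻¹ • (A (s (ψ n)) - 1)) (fun n => by
        rw [mem_closedBall_zero_iff, norm_smul, norm_inv, Real.norm_of_nonneg (hs _).le,
          inv_mul_le_iff₀ (hs _), mul_comm]
        exact hψC n)
    refine ⟨D, fun t => ?_⟩
    have hlim := (hψ.comp hφ).tendsto_atTop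
    have := hS.exp_smul_mem_of_tendsto (s := fun n => s (ψ (φ n))) (ε := fun n => s (ψ (φ n)))
      (fun n => hA _) (fun n => hs _) (hs0.comp hlim) (σ := 1)
      (tendsto_const_nhds.congr fun n => (div_self (hs _).ne').symm) hD t
    simpa using this
  · exfalso
    simp only [not_exists, not_frequently, not_le] at hC
    obtain ⟨N, hN⟩ := eventually_atTop.1 (hC 0)
    -- discard the indices for which the distance to `1` may vanish
    set ε : ℕ → ℝ := fun n => ‖A (s (n + N)) - 1‖ with hεdef
    have hε : ∀ n, 0 < ε n := fun n => by
      have := hN (n + N) (Nat.le_add_left N n)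
      rwa [zero_mul] at this
    have hsh : Tendsto (fun n => n + N) atTop atTop := tendsto_add_atTop_nat N
    have hε0 : Tendsto ε atTop (𝓝 0) := hA1.comp hsh
    obtain ⟨Y, hY, φ, hφ, hYlim⟩ := (isCompact_sphere (0 : 𝔸) 1).tendsto_subseq
      (x := fun n => (ε n)⁻¹ • (A (s (n + N)) - 1)) (fun n => by
        rw [mem_sphere_zero_iff_norm, norm_smul, norm_inv, Real.norm_of_nonneg (hε n).le]
        exact inv_mul_cancel₀ (hε n).ne')
    have hratio : Tendsto (fun n => s (n + N) / ε n) atTop (𝓝 0) := by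
      rw [Metric.tendsto_nhds]
      intro δ hδ
      filter_upwards [hsh.eventually (hC δ⁻¹)] with n hn
      rw [Real.dist_0_eq_abs, abs_of_pos (div_pos (hs _) (hε n)), div_lt_iff₀ (hε n)]
      rwa [inv_mul_lt_iff₀ hδ] at hn
    have hmem : ∀ t : ℝ, NormedSpace.exp (t • Y) ∈ S 0 := fun t => by
      have := hS.exp_smul_mem_of_tendsto (s := fun n => s (φ n + N)) (ε := fun n => ε (φ n))
        (fun n => hA _) (fun n => hε _) (hε0.comp hφ.tendsto_atTop)
        (hratio.comp hφ.tendsto_atTop) hYlim t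
      simpa using this
    have hεφ : Tendsto (fun n => -ε (φ n)) atTop (𝓝 0) := by
      simpa using (hε0.comp hφ.tendsto_atTop).neg
    -- `A n * exp (-ε n • Y)` lies in the same fibre as `A n`, at distance `o(ε n)` from `1`
    have hd := tendsto_inv_smul_exp_smul_sub_one Y hεφ
      (Eventually.of_forall fun n => neg_ne_zero.2 (hε _).ne')
    have hexp : Tendsto (fun n => NormedSpace.exp (-ε (φ n) • Y)) atTop (𝓝 1) := by
      have := (hεφ.smul_const Y).exp
      simpa using this
    have hlim : Tendsto (fun n => ‖(ε (φ n))⁻¹ •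
        (A (s (φ n + N)) * NormedSpace.exp (-ε (φ n) • Y) - 1)‖) atTop (𝓝 0) := by
      have := ((hYlim.mul hexp).sub hd).norm
      rw [mul_one, sub_self, norm_zero] at this
      refine this.congr fun n => ?_
      congr 1
      simp only [Function.comp_apply, smul_mul_assoc, inv_neg, neg_smul, sub_neg_eq_add,
        ← smul_add]
      congr 1
      noncomm_ring
    have hge : ∀ n, 1 ≤ ‖(ε (φ n))⁻¹ •
        (A (s (φ n + N)) * NormedSpace.exp (-ε (φ n) • Y) - 1)‖ := fun n => by
      rw [norm_smul, norm_inv, Real.norm_of_nonneg (hε _).le, ← div_eq_inv_mul,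
        le_div_iff₀ (hε _), one_mul]
      exact hAmin _ _ (by simpa using hS.mul_mem (hA (s (φ n + N))) (hmem (-ε (φ n))))
    have := ge_of_tendsto' hlim hge
    linarith

end IsProperFibration

end OneParameter

/-! ### Limits in probability and convergence of types -/

section Limits

variable {Ω Ω' : Type*} [MeasurableSpace Ω] [MeasurableSpace Ω'] {P : Measure Ω} {P' : Measure Ω'}

/-- Continuous mapping for convergence in measure, with a convergent deterministic parameter. -/
lemma tendstoInMeasure_continuous_comp_param [IsFiniteMeasure P] {C E F : Type*}
    [TopologicalSpace C] [PseudoEMetricSpace E] [PseudoEMetricSpace F] {g : C → E → F}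
    (hg : Continuous fun p : C × E => g p.1 p.2) {c : ℕ → C} {c₀ : C}
    (hc : Tendsto c atTop (𝓝 c₀)) {Y : ℕ → Ω → E} {Z : Ω → E}
    (hY : ∀ n, AEStronglyMeasurable (Y n) P) (h : TendstoInMeasure P Y atTop Z) :
    TendstoInMeasure P (fun n ω => g (c n) (Y n ω)) atTop (fun ω => g c₀ (Z ω)) := by
  have hgY : ∀ n, AEStronglyMeasurable (fun ω => g (c n) (Y n ω)) P := fun n =>
    (hg.comp (Continuous.prodMk_right (c n))).comp_aestronglyMeasurable (hY n)
  rw [exists_seq_tendstoInMeasure_atTop_iff hgY]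
  intro ns hns
  obtain ⟨ns', hns', h'⟩ := (h.comp hns.tendsto_atTop).exists_seq_tendsto_ae
  refine ⟨ns', hns', ?_⟩
  filter_upwards [h'] with ω hω
  exact (hg.tendsto (c₀, Z ω)).comp
    ((hc.comp (hns.comp hns').tendsto_atTop).prodMk_nhds hω)

/-- Limits in probability of identically distributed sequences are identically distributed, since
limits in law are unique. -/
lemma identDistrib_of_tendstoInMeasure [IsProbabilityMeasure P] [IsProbabilityMeasure P']
    {E : Type*} [PseudoEMetricSpace E] [MeasurableSpace E] [BorelSpace E]
    {Z : ℕ → Ω → E} {Z₀ : Ω → E} {W : ℕ → Ω' → E} {W₀ : Ω' → E}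
    (hZ : TendstoInMeasure P Z atTop Z₀) (hW : TendstoInMeasure P' W atTop W₀)
    (h : ∀ n, IdentDistrib (Z n) (W n) P P') : IdentDistrib Z₀ W₀ P P' := by
  have hZm := hZ.tendstoInDistribution fun n => (h n).aemeasurable_fst
  have hWm := hW.tendstoInDistribution fun n => (h n).aemeasurable_snd
  refine ⟨hZm.aemeasurable_limit, hWm.aemeasurable_limit, ?_⟩
  refine tendstoInDistribution_unique Z hZm
    ⟨fun n => (h n).aemeasurable_fst, hWm.aemeasurable_limit, ?_⟩
  refine hWm.tendsto.congr fun n => ?_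
  exact Subtype.ext (h n).map_eq.symm

/-- Either a subsequence converges, or along a subsequence the norms tend to infinity while the
directions converge. -/
lemma exists_subseq_tendsto_or_norm_tendsto_atTop {E : Type*} [NormedAddCommGroup E]
    [NormedSpace ℝ E] [ProperSpace E] (c : ℕ → E) :
    (∃ c₀, ∃ φ : ℕ → ℕ, StrictMono φ ∧ Tendsto (c ∘ φ) atTop (𝓝 c₀)) ∨
    (∃ u : E, ‖u‖ = 1 ∧ ∃ φ : ℕ → ℕ, StrictMono φ ∧
      Tendsto (fun n => ‖c (φ n)‖⁻¹) atTop (𝓝 0) ∧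
      Tendsto (fun n => ‖c (φ n)‖⁻¹ • c (φ n)) atTop (𝓝 u)) := by
  by_cases h : ∃ R : ℝ, ∃ᶠ n in atTop, ‖c n‖ ≤ R
  · left
    obtain ⟨R, hR⟩ := h
    obtain ⟨ψ, hψ, hψR⟩ := extraction_of_frequently_atTop hR
    obtain ⟨c₀, -, φ, hφ, hc⟩ := tendsto_subseq_of_bounded
      (Metric.isBounded_closedBall (x := (0 : E)) (r := R)) (x := c ∘ ψ) (fun n => by
        simpa using hψR n)
    exact ⟨c₀, ψ ∘ φ, hψ.comp hφ, hc⟩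
  · right
    simp only [not_exists, not_frequently, not_le] at h
    have hinf : Tendsto (fun n => ‖c n‖) atTop atTop :=
      tendsto_atTop.2 fun R => (h R).mono fun n hn => hn.le
    obtain ⟨N, hN⟩ := eventually_atTop.1 (h 0)
    obtain ⟨u, hu, φ, hφ, hlim⟩ := (isCompact_sphere (0 : E) 1).tendsto_subseq
      (x := fun n => ‖c (n + N)‖⁻¹ • c (n + N)) (fun n => by
        rw [mem_sphere_zero_iff_norm, norm_smul, norm_inv, norm_norm]
        exact inv_mul_cancel₀ (hN _ (Nat.le_add_left N n)).ne')
    have hmono : StrictMono fun n => φ n + N := fun a b hab => Nat.add_lt_add_right (hφ hab) N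
    exact ⟨u, by simpa using hu, fun n => φ n + N, hmono,
      (hinf.comp hmono.tendsto_atTop).inv_tendsto_atTop, hlim⟩

variable {V : Type*} [NormedAddCommGroup V] [InnerProductSpace ℝ V]

/-- A random vector is linearly full if it is not almost surely contained in a hyperplane through
the origin. -/
def IsLinearlyFull (P : Measure Ω) (Y : Ω → V) : Prop :=
  ∀ v : V, (∀ᵐ ω ∂P, inner ℝ v (Y ω) = 0) → v = 0

lemma IsLinearlyFull.clm_eq_zero [FiniteDimensional ℝ V] {Y : Ω → V} (hY : IsLinearlyFull P Y) {C : V →L[ℝ] V}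
    (h : ∀ᵐ ω ∂P, C (Y ω) = 0) : C = 0 := by
  have : ContinuousLinearMap.adjoint C = 0 := by
    ext v
    refine hY _ ?_
    filter_upwards [h] with ω hω
    rw [ContinuousLinearMap.adjoint_inner_left, hω, inner_zero_right]
  simpa using congrArg ContinuousLinearMap.adjoint this

variable [FiniteDimensional ℝ V] [MeasurableSpace V] [BorelSpace V]

lemma ae_eq_of_identDistrib_const {E : Type*} [MeasurableSpace E] [MeasurableSingletonClass E]
    {Z : Ω → E} {a : E} (h : IdentDistrib Z (fun _ => a) P P') : ∀ᵐ ω ∂P, Z ω = a :=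
  h.symm.ae_snd (p := fun x => x = a) (measurableSet_singleton a) (by simp)

section Shift

variable [IsProbabilityMeasure P']

/-- Compactness of types for shifts. -/
lemma exists_subseq_tendsto_of_identDistrib_add [IsProbabilityMeasure P] {Z : ℕ → Ω → V}
    {Z₀ : Ω → V} {W : ℕ → Ω' → V} {W₀ : Ω' → V} {c : ℕ → V} (hZ : TendstoInMeasure P Z atTop Z₀)
    (hW : TendstoInMeasure P' W atTop W₀) (hWm : ∀ n, AEMeasurable (W n) P')
    (h : ∀ n, IdentDistrib (Z n) (fun ω => W n ω + c n) P P') :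
    ∃ c₀, ∃ φ : ℕ → ℕ, StrictMono φ ∧ Tendsto (c ∘ φ) atTop (𝓝 c₀) ∧
      IdentDistrib Z₀ (fun ω => W₀ ω + c₀) P P' := by
  have := FiniteDimensional.proper ℝ V
  have hZm : ∀ n, AEStronglyMeasurable (Z n) P := fun n =>
    (h n).aemeasurable_fst.aestronglyMeasurable
  have hWm' : ∀ n, AEStronglyMeasurable (W n) P' := fun n => (hWm n).aestronglyMeasurable
  rcases exists_subseq_tendsto_or_norm_tendsto_atTop c with ⟨c₀, φ, hφ, hc⟩ | ⟨u, hu, φ, hφ, h0, hc⟩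
  · refine ⟨c₀, φ, hφ, hc, ?_⟩
    refine identDistrib_of_tendstoInMeasure (hZ.comp hφ.tendsto_atTop)
      (W := fun n ω => W (φ n) ω + c (φ n)) ?_ (fun n => h (φ n))
    exact tendstoInMeasure_continuous_comp_param (g := fun (c : V) x => x + c) (by fun_prop) hc
      (fun n => hWm' (φ n)) (hW.comp hφ.tendsto_atTop)
  · -- dividing by the norms of the shifts makes both sides converge to distinct constants
    exfalso
    have h1 : TendstoInMeasure P (fun n ω => ‖c (φ n)‖⁻¹ • Z (φ n) ω) atTop
        (fun ω => (0 : ℝ) • Z₀ ω) :=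
      tendstoInMeasure_continuous_comp_param (g := fun (c : ℝ) (x : V) => c • x) (by fun_prop) h0
        (fun n => hZm (φ n)) (hZ.comp hφ.tendsto_atTop)
    have h2 : TendstoInMeasure P'
        (fun n ω => ‖c (φ n)‖⁻¹ • W (φ n) ω + ‖c (φ n)‖⁻¹ • c (φ n)) atTop (fun ω => (0 : ℝ) • W₀ ω + u) :=
      tendstoInMeasure_continuous_comp_param (g := fun (c : ℝ × V) (x : V) => c.1 • x + c.2)
        (c := fun n => (‖c (φ n)‖⁻¹, ‖c (φ n)‖⁻¹ • c (φ n))) (by fun_prop) (h0.prodMk_nhds hc)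
        (fun n => hWm' (φ n)) (hW.comp hφ.tendsto_atTop)
    have h3 := identDistrib_of_tendstoInMeasure h1 h2 fun n => by
      have := (h (φ n)).comp (u := fun x : V => ‖c (φ n)‖⁻¹ • x) (by fun_prop)
      simpa [Function.comp_def, smul_add] using this
    simp only [zero_smul, zero_add] at h3
    obtain ⟨ω, hω⟩ := (ae_eq_of_identDistrib_const h3).exists
    rw [← hω, norm_zero] at hu
    exact zero_ne_one hu

/-- Two shifts of a vector with the same law are equal: their difference would be a period of the
law, and the multiples of a period are bounded by compactness of types. -/
lemma eq_of_identDistrib_add {Z : Ω → V} {W : Ω' → V} {c c' : V} (hWm : AEMeasurable W P')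
    (h : IdentDistrib Z (fun ω => W ω + c) P P') (h' : IdentDistrib Z (fun ω => W ω + c') P P') :
    c = c' := by
  have hstep : IdentDistrib W (fun ω => W ω + (c' - c)) P' P' := by
    have := (h.symm.trans h').comp (u := fun x : V => x - c) (by fun_prop)
    simpa [Function.comp_def, add_sub_assoc] using this
  have hiter : ∀ n : ℕ, IdentDistrib W (fun ω => W ω + (n : ℝ) • (c' - c)) P' P' := by
    intro n
    induction n with
    | zero => simpa using IdentDistrib.refl hWm
    | succ n ih =>
      have := hstep.trans (ih.comp (u := fun x : V => x + (c' - c)) (by fun_prop))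
      simpa [Function.comp_def, add_smul, add_assoc] using this
  have hconst : TendstoInMeasure P' (fun _ : ℕ => W) atTop W := fun ε hε => by
    simp [hε.ne']
  obtain ⟨c₀, φ, hφ, hc, -⟩ := exists_subseq_tendsto_of_identDistrib_add hconst hconst
    (fun _ => hWm) hiter
  by_contra hne
  have hpos : 0 < ‖c' - c‖ := norm_pos_iff.2 (sub_ne_zero.2 (Ne.symm hne))
  have hinf : Tendsto (fun n => (φ n : ℝ) * ‖c' - c‖) atTop atTop :=
    (tendsto_natCast_atTop_atTop.comp hφ.tendsto_atTop).atTop_mul_const hpos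
  refine not_tendsto_nhds_of_tendsto_atTop hinf ‖c₀‖ ?_
  refine hc.norm.congr fun n => ?_
  simp [norm_smul]

/-- If `Z n` and `W n` converge in probability and `Z n` has the law of `W n + c n`, then `c n`
converges. All subsequential limits agree because the law of `Z₀` determines the shift. -/
lemma exists_tendsto_of_identDistrib_add [IsProbabilityMeasure P] {Z : ℕ → Ω → V} {Z₀ : Ω → V} {W : ℕ → Ω' → V}
    {W₀ : Ω' → V} {c : ℕ → V} (hZ : TendstoInMeasure P Z atTop Z₀)
    (hW : TendstoInMeasure P' W atTop W₀) (hWm : ∀ n, AEMeasurable (W n) P')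
    (hWm₀ : AEMeasurable W₀ P')
    (h : ∀ n, IdentDistrib (Z n) (fun ω => W n ω + c n) P P') :
    ∃ c₀, Tendsto c atTop (𝓝 c₀) ∧ IdentDistrib Z₀ (fun ω => W₀ ω + c₀) P P' := by
  obtain ⟨c₀, -, -, -, hc₀⟩ := exists_subseq_tendsto_of_identDistrib_add hZ hW hWm h
  refine ⟨c₀, tendsto_of_subseq_tendsto fun ns hns => ?_, hc₀⟩
  obtain ⟨c₁, φ, hφ, hc, hc₁⟩ := exists_subseq_tendsto_of_identDistrib_add (hZ.comp hns)
    (hW.comp hns) (fun n => hWm (ns n)) (fun n => h (ns n))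
  rw [eq_of_identDistrib_add hWm₀ hc₀ hc₁]
  exact ⟨φ, hc⟩

lemma tendsto_of_identDistrib_add [IsProbabilityMeasure P] {Z : ℕ → Ω → V} {Z₀ : Ω → V} {W : ℕ → Ω' → V}
    {W₀ : Ω' → V} {c : ℕ → V} {c₀ : V} (hZ : TendstoInMeasure P Z atTop Z₀)
    (hW : TendstoInMeasure P' W atTop W₀) (hWm : ∀ n, AEMeasurable (W n) P')
    (hWm₀ : AEMeasurable W₀ P')
    (h : ∀ n, IdentDistrib (Z n) (fun ω => W n ω + c n) P P')
    (h₀ : IdentDistrib Z₀ (fun ω => W₀ ω + c₀) P P') : Tendsto c atTop (𝓝 c₀) := by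
  obtain ⟨c₁, hc₁, h₁⟩ := exists_tendsto_of_identDistrib_add hZ hW hWm hWm₀ h
  rwa [eq_of_identDistrib_add hWm₀ h₀ h₁]

end Shift

/-- Compactness of types for linear normalizations: if `B n` were unbounded, a limit `C` of the
normalized maps would have norm one and satisfy `C Y = 0` almost surely. -/
lemma IsLinearlyFull.exists_subseq_tendsto [IsProbabilityMeasure P] [IsProbabilityMeasure P']
    {Y : Ω' → V} (hY : IsLinearlyFull P' Y) (hYm : AEMeasurable Y P')
    {Z : ℕ → Ω → V} {Z₀ : Ω → V} {B : ℕ → V →L[ℝ] V} (hZ : TendstoInMeasure P Z atTop Z₀)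
    (h : ∀ n, IdentDistrib (Z n) (fun ω => B n (Y ω)) P P') :
    ∃ B₀, ∃ φ : ℕ → ℕ, StrictMono φ ∧ Tendsto (B ∘ φ) atTop (𝓝 B₀) ∧
      IdentDistrib Z₀ (fun ω => B₀ (Y ω)) P P' := by
  have := FiniteDimensional.proper ℝ (V →L[ℝ] V)
  have hconst : TendstoInMeasure P' (fun _ : ℕ => Y) atTop Y := fun ε hε => by
    simp [hε.ne']
  have happ : ∀ {B : ℕ → V →L[ℝ] V} {B₀}, Tendsto B atTop (𝓝 B₀) →
      TendstoInMeasure P' (fun n ω => B n (Y ω)) atTop (fun ω => B₀ (Y ω)) := fun hB =>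
    tendstoInMeasure_continuous_comp_param (g := fun (B : V →L[ℝ] V) x => B x) (by fun_prop) hB
      (fun _ => hYm.aestronglyMeasurable) hconst
  rcases exists_subseq_tendsto_or_norm_tendsto_atTop B with ⟨B₀, φ, hφ, hB⟩ | ⟨C, hC, φ, hφ, h0, hB⟩
  · exact ⟨B₀, φ, hφ, hB, identDistrib_of_tendstoInMeasure (hZ.comp hφ.tendsto_atTop) (happ hB)
      (fun n => h (φ n))⟩
  · exfalso
    have h1 : TendstoInMeasure P (fun n ω => ‖B (φ n)‖⁻¹ • Z (φ n) ω) atTop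
        (fun ω => (0 : ℝ) • Z₀ ω) :=
      tendstoInMeasure_continuous_comp_param (g := fun (c : ℝ) (x : V) => c • x) (by fun_prop) h0
        (fun n => (h (φ n)).aemeasurable_fst.aestronglyMeasurable) (hZ.comp hφ.tendsto_atTop)
    have h3 := identDistrib_of_tendstoInMeasure h1 (happ hB) fun n => by
      have := (h (φ n)).comp (u := fun x : V => ‖B (φ n)‖⁻¹ • x) (by fun_prop)
      simpa [Function.comp_def] using this
    simp only [zero_smul] at h3
    rw [hY.clm_eq_zero (ae_eq_of_identDistrib_const h3.symm), norm_zero] at hC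
    exact zero_ne_one hC

end Limits

/-! ### Symmetrization -/

section Symmetrization

variable {Ω : Type*} [MeasurableSpace Ω] {P : Measure Ω} [IsProbabilityMeasure P]
  {V : Type*} [NormedAddCommGroup V] [InnerProductSpace ℝ V] [FiniteDimensional ℝ V]
  [MeasurableSpace V] [BorelSpace V]

/-- The symmetrization of a random vector: the difference of two independent copies, on the
product probability space. -/
def symmetrize {Ω V : Type*} [Sub V] (X : Ω → V) (p : Ω × Ω) : V := X p.1 - X p.2

lemma measurable_symmetrize {X : Ω → V} (hX : Measurable X) : Measurable (symmetrize X) :=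
  (hX.comp measurable_fst).sub (hX.comp measurable_snd)

lemma identDistrib_symmetrize {X Y : Ω → V} (hX : Measurable X) (hY : Measurable Y)
    (h : IdentDistrib X Y P P) :
    IdentDistrib (symmetrize X) (symmetrize Y) (P.prod P) (P.prod P) := by
  have h1 : IdentDistrib (Prod.map X X) (Prod.map Y Y) (P.prod P) (P.prod P) :=
    ⟨(hX.prodMap hX).aemeasurable, (hY.prodMap hY).aemeasurable, by
      rw [← Measure.map_prod_map _ _ hX hX, ← Measure.map_prod_map _ _ hY hY, h.map_eq]⟩
  exact h1.comp (u := fun p : V × V => p.1 - p.2) (by fun_prop)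

/-- Symmetrization removes shifts. -/
lemma identDistrib_symmetrize_of_add {X Y : Ω → V} (hX : Measurable X) (hY : Measurable Y)
    {B : V →L[ℝ] V} {a : V} (h : IdentDistrib X (fun ω => B (Y ω) + a) P P) :
    IdentDistrib (symmetrize X) (fun p => B (symmetrize Y p)) (P.prod P) (P.prod P) := by
  convert identDistrib_symmetrize hX (by fun_prop) h using 2 with p
  simp [symmetrize]

lemma tendstoInMeasure_symmetrize {X : ℕ → Ω → V} {X₀ : Ω → V} (hX : ∀ n, Measurable (X n))
    (h : TendstoInMeasure P X atTop X₀) :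
    TendstoInMeasure (P.prod P) (fun n => symmetrize (X n)) atTop (symmetrize X₀) := by
  rw [exists_seq_tendstoInMeasure_atTop_iff
    fun n => (measurable_symmetrize (hX n)).aestronglyMeasurable]
  intro ns hns
  obtain ⟨ns', hns', h'⟩ := (h.comp hns.tendsto_atTop).exists_seq_tendsto_ae
  refine ⟨ns', hns', ?_⟩
  filter_upwards [Measure.quasiMeasurePreserving_fst.ae h',
    Measure.quasiMeasurePreserving_snd.ae h'] with p h1 h2
  exact h1.sub h2

lemma exists_ae_eq_const_of_symmetrize {E : Type*} [AddGroup E] {X : Ω → E}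
    (h : ∀ᵐ p ∂(P.prod P), symmetrize X p = 0) : ∃ a, ∀ᵐ ω ∂P, X ω = a := by
  obtain ⟨ω, hω⟩ := (Measure.ae_ae_of_ae_prod h).exists
  exact ⟨X ω, hω.mono fun ω' h' => (sub_eq_zero.1 h').symm⟩

lemma symmetrize_ae_eq_zero {Ω : Type*} [MeasurableSpace Ω] {P : Measure Ω} {E : Type*}
    [AddGroup E] {X : Ω → E} {a : E} (h : ∀ᵐ ω ∂P, X ω = a) :
    ∀ᵐ p ∂(P.prod P), symmetrize X p = 0 := by
  filter_upwards [Measure.quasiMeasurePreserving_fst.ae h,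
    Measure.quasiMeasurePreserving_snd.ae h] with p h1 h2
  rw [symmetrize, h1, h2, sub_self]

/-- A linear functional vanishing on the symmetrization of `X` is constant on `X`. -/
lemma IsFull.isLinearlyFull_symmetrize {m : ℕ} {X : Ω → EuclideanSpace ℝ (Fin m)}
    (hX : Measurable X) (h : IsFull (P.map X)) : IsLinearlyFull (P.prod P) (symmetrize X) := by
  intro v hv
  by_contra hne
  obtain ⟨c, hc⟩ := exists_ae_eq_const_of_symmetrize (X := fun ω => inner ℝ v (X ω))
    (hv.mono fun p hp => by simpa [symmetrize, inner_sub_right] using hp)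
  have hcl : IsClosed {x : EuclideanSpace ℝ (Fin m) | inner ℝ v x = c} :=
    isClosed_eq (by fun_prop) continuous_const
  refine h v c hne (Measure.support_subset_of_isClosed hcl ?_)
  exact (ae_map_iff hX.aemeasurable hcl.measurableSet).2 hc

end Symmetrization

/-! ### Finite-dimensional distributions -/

section FiniteDimensionalDistributions

variable {T T' Ω F F' : Type*} [MeasurableSpace Ω] [MeasurableSpace F] [MeasurableSpace F']
  {P : Measure Ω} {X Y Z : T → Ω → F}

namespace EqFDD

lemma symm (h : EqFDD P X Y) : EqFDD P Y X := fun I => (h I).symm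

lemma trans (h : EqFDD P X Y) (h' : EqFDD P Y Z) : EqFDD P X Z := fun I => (h I).trans (h' I)

lemma identDistrib (h : EqFDD P X Y) (t : T) : IdentDistrib (X t) (Y t) P P :=
  (h {t}).comp (u := fun x : ({t} : Finset T) → F => x ⟨t, Finset.mem_singleton_self t⟩)
    (measurable_pi_apply _)

lemma reindex (h : EqFDD P X Y) (g : T' → T) : EqFDD P (fun t => X (g t)) (fun t => Y (g t)) := by
  classical
  intro I
  exact (h (I.image g)).comp
    (u := fun x (t : I) => x ⟨g t, Finset.mem_image_of_mem g t.2⟩)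
    (measurable_pi_lambda _ fun _ => measurable_pi_apply _)

lemma map (h : EqFDD P X Y) {φ : T → F → F'} (hφ : ∀ t, Measurable (φ t)) :
    EqFDD P (fun t ω => φ t (X t ω)) (fun t ω => φ t (Y t ω)) := fun I =>
  (h I).comp (u := fun (x : I → F) (t : I) => φ t (x t))
    (measurable_pi_lambda _ fun t => (hφ t).comp (measurable_pi_apply t))

end EqFDD

lemma tendstoInMeasure_pi {ι E : Type*} [Fintype ι] [PseudoEMetricSpace E]
    {X : ℕ → ι → Ω → E} {X₀ : ι → Ω → E}
    (h : ∀ t, TendstoInMeasure P (fun n => X n t) atTop (X₀ t)) :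
    TendstoInMeasure P (fun n ω t => X n t ω) atTop (fun ω t => X₀ t ω) := by
  intro ε hε
  have hsum : Tendsto (fun n => ∑ t, P {ω | ε ≤ edist (X n t ω) (X₀ t ω)}) atTop (𝓝 0) := by
    simpa using tendsto_finsetSum (Finset.univ : Finset ι) fun t _ => h t ε hε
  refine tendsto_of_tendsto_of_tendsto_of_le_of_le tendsto_const_nhds hsum (fun _ => zero_le)
    fun n => ?_
  refine (measure_mono fun ω hω => ?_).trans (measure_iUnion_fintype_le P _)
  rw [Set.mem_ofPred_eq, edist_pi_def, Finset.le_sup_iff (by simpa using hε)] at hω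
  obtain ⟨t, -, ht⟩ := hω
  exact Set.mem_iUnion.2 ⟨t, ht⟩

lemma EqFDD.of_tendstoInMeasure [IsProbabilityMeasure P] {E : Type*} [PseudoEMetricSpace E]
    [SecondCountableTopology E] [MeasurableSpace E] [BorelSpace E] {X Y : ℕ → T → Ω → E}
    {X₀ Y₀ : T → Ω → E} (hX : ∀ t, TendstoInMeasure P (fun n => X n t) atTop (X₀ t))
    (hY : ∀ t, TendstoInMeasure P (fun n => Y n t) atTop (Y₀ t))
    (h : ∀ n, EqFDD P (X n) (Y n)) : EqFDD P X₀ Y₀ := fun I =>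
  identDistrib_of_tendstoInMeasure
    (tendstoInMeasure_pi (X := fun n (t : I) => X n t) fun t => hX t)
    (tendstoInMeasure_pi (X := fun n (t : I) => Y n t) fun t => hY t) fun n => h n I

end FiniteDimensionalDistributions

/-! ### The group of scaling maps -/

section Scaling

variable {Ω : Type*} [MeasurableSpace Ω] {P : Measure Ω}
  {U : Type*} [NormedAddCommGroup U] [NormedSpace ℝ U]
  {V : Type*} [NormedAddCommGroup V] [InnerProductSpace ℝ V]
  [MeasurableSpace V]

/-- The linear parts of the affine maps which produce, in law, the field `X` with its time
rescaled by `exp (s • F)`. -/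
def scalingSet (P : Measure Ω) (X : U → Ω → V) (F : U →L[ℝ] U) (s : ℝ) : Set (V →L[ℝ] V) :=
  {A | ∃ a : U → V,
    EqFDD P (fun t => X (NormedSpace.exp (s • F) t)) (fun t ω => A (X t ω) + a t)}

lemma exp_smul_mul_exp_smul {𝔸 : Type*} [NormedRing 𝔸] [NormedAlgebra ℝ 𝔸] [CompleteSpace 𝔸]
    (F : 𝔸) (s t : ℝ) :
    NormedSpace.exp (s • F) * NormedSpace.exp (t • F) = NormedSpace.exp ((s + t) • F) := by
  let : NormedAlgebra ℚ 𝔸 := NormedAlgebra.restrictScalars ℚ ℝ 𝔸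
  rw [add_smul, NormedSpace.exp_add_of_commute (((Commute.refl F).smul_left _).smul_right _)]

lemma exp_smul_apply_exp_smul [CompleteSpace U] (F : U →L[ℝ] U) (s t : ℝ) (u : U) :
    NormedSpace.exp (s • F) (NormedSpace.exp (t • F) u) = NormedSpace.exp ((s + t) • F) u :=
  DFunLike.congr_fun (exp_smul_mul_exp_smul F s t) u

lemma exp_smul_apply_ne_zero [CompleteSpace U] (F : U →L[ℝ] U) (s : ℝ) {u : U} (hu : u ≠ 0) :
    NormedSpace.exp (s • F) u ≠ 0 := fun h => hu <| by
  simpa [h, NormedSpace.exp_zero] using (exp_smul_apply_exp_smul F (-s) s u).symm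

lemma continuous_exp_smul {𝔸 : Type*} [NormedRing 𝔸] [NormedAlgebra ℝ 𝔸] [CompleteSpace 𝔸]
    (F : 𝔸) : Continuous fun s : ℝ => NormedSpace.exp (s • F) := by
  let : NormedAlgebra ℚ 𝔸 := NormedAlgebra.restrictScalars ℚ ℝ 𝔸
  exact NormedSpace.exp_continuous.comp (by fun_prop)

variable [BorelSpace V] {X : U → Ω → V} {F : U →L[ℝ] U}

lemma mul_mem_scalingSet [CompleteSpace U] {s t : ℝ} {A B : V →L[ℝ] V}
    (hA : A ∈ scalingSet P X F s) (hB : B ∈ scalingSet P X F t) :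
    A * B ∈ scalingSet P X F (s + t) := by
  obtain ⟨a, ha⟩ := hA
  obtain ⟨b, hb⟩ := hB
  refine ⟨fun u => A (b u) + a (NormedSpace.exp (t • F) u), ?_⟩
  have h1 := ha.reindex fun u => NormedSpace.exp (t • F) u
  have h2 := hb.map (φ := fun u x => A x + a (NormedSpace.exp (t • F) u)) (fun u => by fun_prop)
  have := h1.trans h2
  simpa only [exp_smul_apply_exp_smul, map_add, add_assoc, mul_apply_eq_comp] using this

variable [FiniteDimensional ℝ V] [IsProbabilityMeasure P]

/-- The linear parts of scaling maps are invertible, and the inverse scaling is again affine. -/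
lemma exists_inv_mem_scalingSet [CompleteSpace U] (hX : ∀ t, Measurable (X t))
    (hfull : ∀ t, t ≠ 0 → IsLinearlyFull (P.prod P) (symmetrize (X t))) [Nontrivial U]
    {s : ℝ} {A : V →L[ℝ] V} (hA : A ∈ scalingSet P X F s) :
    ∃ B ∈ scalingSet P X F (-s), A * B = 1 ∧ B * A = 1 := by
  obtain ⟨a, ha⟩ := hA
  obtain ⟨t₀, ht₀⟩ := exists_ne (0 : U)
  have hsym := identDistrib_symmetrize_of_add (hX _) (hX _) (ha.identDistrib t₀)
  -- the range of `A` is not contained in a hyperplane, since the rescaled field is full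
  have hinj : Function.Injective (ContinuousLinearMap.adjoint A) := by
    refine (injective_iff_map_eq_zero _).2 fun v hv => ?_
    refine hfull _ (exp_smul_apply_ne_zero F s ht₀) v ?_
    refine hsym.symm.ae_snd (p := fun x => inner ℝ v x = 0)
      (isClosed_eq (by fun_prop) continuous_const).measurableSet ?_
    refine Eventually.of_forall fun p => ?_
    rw [← ContinuousLinearMap.adjoint_inner_left, hv, inner_zero_left]
  obtain ⟨C, hC1, hC2⟩ : ∃ C : V →L[ℝ] V, ContinuousLinearMap.adjoint A * C = 1 ∧
      C * ContinuousLinearMap.adjoint A = 1 := by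
    let e := (LinearEquiv.ofInjectiveEndo (ContinuousLinearMap.adjoint A).toLinearMap
      hinj).toContinuousLinearEquiv
    have he : ∀ x, e x = ContinuousLinearMap.adjoint A x := fun x => rfl
    refine ⟨e.symm, ?_, ?_⟩ <;> ext x
    · simp [← he]
    · simp [← he]
  have hB1 : A * ContinuousLinearMap.adjoint C = 1 := by
    simpa [← ContinuousLinearMap.star_eq_adjoint] using congrArg star hC2
  have hB2 : ContinuousLinearMap.adjoint C * A = 1 := by
    simpa [← ContinuousLinearMap.star_eq_adjoint] using congrArg star hC1
  set B := ContinuousLinearMap.adjoint C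
  refine ⟨B, ⟨fun u => -B (a (NormedSpace.exp (-s • F) u)), ?_⟩, hB1, hB2⟩
  have hBA : ∀ x, B (A x) = x := fun x => DFunLike.congr_fun hB2 x
  have h1 := (ha.reindex fun u => NormedSpace.exp (-s • F) u).symm.map
    (φ := fun u x => B (x - a (NormedSpace.exp (-s • F) u))) (fun u => by fun_prop)
  simp only [exp_smul_apply_exp_smul, map_sub, hBA, add_sub_cancel_right] at h1
  simpa [hBA, NormedSpace.exp_zero, sub_eq_add_neg] using h1

lemma tendstoInMeasure_clm_apply {U : Type*} [TopologicalSpace U] {X : U → Ω → V}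
    (hX : ∀ t, Measurable (X t)) (hcont : ∀ t, TendstoInMeasure P X (𝓝 t) (X t)) {A : ℕ → V →L[ℝ] V} {A₀ : V →L[ℝ] V} {t : ℕ → U} {t₀ : U}
    (hA : Tendsto A atTop (𝓝 A₀)) (ht : Tendsto t atTop (𝓝 t₀)) :
    TendstoInMeasure P (fun n ω => A n (X (t n) ω)) atTop (fun ω => A₀ (X t₀ ω)) :=
  tendstoInMeasure_continuous_comp_param (g := fun (A : V →L[ℝ] V) x => A x) (by fun_prop) hA
    (fun n => (hX (t n)).aestronglyMeasurable) ((hcont t₀).comp ht)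

variable (hX : ∀ t, Measurable (X t)) (hcont : ∀ t, TendstoInMeasure P X (𝓝 t) (X t))
include hX hcont

/-- If the times `exp (s n • F) t` converge, then so does a subsequence of the linear parts `A n`
of the corresponding scaling maps. -/
lemma exists_subseq_tendsto_of_mem_scalingSet
    (hfull : ∀ t, t ≠ 0 → IsLinearlyFull (P.prod P) (symmetrize (X t))) {s : ℕ → ℝ} {t t₀ : U}
    (ht : t ≠ 0) {A : ℕ → V →L[ℝ] V} (hA : ∀ n, A n ∈ scalingSet P X F (s n))
    (hs : Tendsto (fun n => NormedSpace.exp (s n • F) t) atTop (𝓝 t₀)) :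
    ∃ A₀, ∃ φ : ℕ → ℕ, StrictMono φ ∧ Tendsto (A ∘ φ) atTop (𝓝 A₀) ∧
      IdentDistrib (symmetrize (X t₀)) (fun p => A₀ (symmetrize (X t) p))
        (P.prod P) (P.prod P) := by
  refine (hfull t ht).exists_subseq_tendsto (measurable_symmetrize (hX t)).aemeasurable
    (tendstoInMeasure_symmetrize (fun n => hX _) ((hcont t₀).comp hs)) fun n => ?_
  obtain ⟨a, ha⟩ := hA n
  exact identDistrib_symmetrize_of_add (hX _) (hX _) (ha.identDistrib t)

theorem isProperFibration_scalingSet [CompleteSpace U] [Nontrivial U]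
    (hfull : ∀ t, t ≠ 0 → IsLinearlyFull (P.prod P) (symmetrize (X t)))
    (hne : ∀ s, (scalingSet P X F s).Nonempty) :
    IsProperFibration (scalingSet P X F) where
  nonempty := hne
  mul_mem := mul_mem_scalingSet
  exists_inv := exists_inv_mem_scalingSet hX hfull
  exists_tendsto {s A s₀} hs hA := by
    obtain ⟨t₀, ht₀⟩ := exists_ne (0 : U)
    have hexp : ∀ t, Tendsto (fun n => NormedSpace.exp (s n • F) t) atTop
        (𝓝 (NormedSpace.exp (s₀ • F) t)) := fun t =>
      (((continuous_exp_smul F).clm_apply continuous_const).tendsto s₀).comp hs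
    obtain ⟨A₀, φ, hφ, hA₀, -⟩ :=
      exists_subseq_tendsto_of_mem_scalingSet hX hcont hfull ht₀ hA (hexp t₀)
    refine ⟨A₀, ?_, φ, hφ, hA₀⟩
    choose a ha using hA
    have hZ : ∀ t, TendstoInMeasure P (fun n => X (NormedSpace.exp (s (φ n) • F) t)) atTop
        (X (NormedSpace.exp (s₀ • F) t)) := fun t =>
      (hcont _).comp ((hexp t).comp hφ.tendsto_atTop)
    have hW : ∀ t, TendstoInMeasure P (fun n ω => A (φ n) (X t ω)) atTop
        (fun ω => A₀ (X t ω)) := fun t =>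
      tendstoInMeasure_clm_apply hX hcont hA₀ (tendsto_const_nhds (x := t))
    have hm : ∀ (B : V →L[ℝ] V) t, Measurable fun ω => B (X t ω) := fun B t =>
      B.continuous.measurable.comp (hX t)
    -- for each time the shifts converge, as both sides of the scaling relation do
    have hshift : ∀ t, ∃ c, Tendsto (fun n => a (φ n) t) atTop (𝓝 c) := fun t => by
      obtain ⟨c, hc, -⟩ := exists_tendsto_of_identDistrib_add (hZ t) (hW t)
        (fun n => (hm _ t).aemeasurable) (hm _ t).aemeasurable
        (fun n => (ha (φ n)).identDistrib t)
      exact ⟨c, hc⟩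
    choose c hc using hshift
    refine ⟨c, EqFDD.of_tendstoInMeasure hZ (fun t => ?_) fun n => ha (φ n)⟩
    exact tendstoInMeasure_continuous_comp_param
      (g := fun (p : (V →L[ℝ] V) × V) x => p.1 x + p.2) (by fun_prop) (hA₀.prodMk_nhds (hc t))
      (fun n => (hX t).aestronglyMeasurable)
      (by intro ε hε; simp [hε.ne'])

/-- Convergence of the shifts, given convergence of the rescaled times and of the linear parts. -/
lemma tendsto_shift {s : ℕ → ℝ} {t : ℕ → U} {t₀ t₁ : U} {A : ℕ → V →L[ℝ] V} {A₀ : V →L[ℝ] V}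
    {c : ℕ → V} {c₀ : V} (ht : Tendsto t atTop (𝓝 t₀)) (hA : Tendsto A atTop (𝓝 A₀))
    (hs : Tendsto (fun n => NormedSpace.exp (s n • F) (t n)) atTop (𝓝 t₁))
    (h : ∀ n, IdentDistrib (X (NormedSpace.exp (s n • F) (t n)))
      (fun ω => A n (X (t n) ω) + c n) P P)
    (h₀ : IdentDistrib (X t₁) (fun ω => A₀ (X t₀ ω) + c₀) P P) : Tendsto c atTop (𝓝 c₀) := by
  have hm : ∀ (B : V →L[ℝ] V) t, Measurable fun ω => B (X t ω) := fun B t =>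
    B.continuous.measurable.comp (hX t)
  exact tendsto_of_identDistrib_add ((hcont t₁).comp hs)
    (tendstoInMeasure_clm_apply hX hcont hA ht) (fun n => (hm _ _).aemeasurable)
    (hm _ _).aemeasurable h h₀

end Scaling

/-! ### Decay and boundedness of matrix exponentials -/

section MatrixExponential

open scoped Matrix.Norms.Operator Nat Matrix

variable {n : ℕ} {A : Matrix (Fin n) (Fin n) ℂ}

/-- The matrix exponential on a generalized eigenvector: the exponential series of the nilpotent
part is a finite sum. -/
lemma exp_smul_mulVec_of_pow_mulVec_eq_zero (c z : ℂ) {k : ℕ} {w : Fin n → ℂ}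
    (hw : (A - z • 1) ^ k *ᵥ w = 0) :
    NormedSpace.exp (c • A) *ᵥ w =
      Complex.exp (c * z) • ∑ j ∈ Finset.range k, (c ^ j / j !) • ((A - z • 1) ^ j *ᵥ w) := by
  set N := A - z • 1 with hN
  have h1 : NormedSpace.exp (c • A) = Complex.exp (c * z) • NormedSpace.exp (c • N) := by
    have e : c • A = algebraMap ℂ _ (c * z) + c • N := by
      rw [hN, Algebra.algebraMap_eq_smul_one, smul_sub, smul_smul]; abel
    have e' := NormedSpace.algebraMap_exp_comm (𝔸 := Matrix (Fin n) (Fin n) ℂ) (c * z)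
    rw [e, Matrix.exp_add_of_commute _ _ (Algebra.commute_algebraMap_left _ _)]
    refine (congrArg (· * NormedSpace.exp (c • N)) e'.symm).trans ?_
    simp only [Algebra.algebraMap_eq_smul_one, smul_mul_assoc, one_mul, Complex.exp_eq_exp_ℂ]
  have h2 : HasSum (fun j : ℕ => ((j ! : ℂ)⁻¹ • (c • N) ^ j) *ᵥ w)
      (NormedSpace.exp (c • N) *ᵥ w) :=
    (NormedSpace.exp_series_hasSum_exp' (𝕂 := ℂ) (c • N)).map
      (Matrix.mulVecBilin ℂ ℂ |>.flip w) (by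
        change Continuous fun M : Matrix (Fin n) (Fin n) ℂ => M *ᵥ w
        fun_prop)
  have h3 : ∀ j : ℕ, ((j ! : ℂ)⁻¹ • (c • N) ^ j) *ᵥ w = (c ^ j / j !) • (N ^ j *ᵥ w) := fun j => by
    rw [smul_pow, smul_smul, Matrix.smul_mulVec, inv_mul_eq_div]
  simp only [h3] at h2
  have h4 : HasSum (fun j : ℕ => (c ^ j / (j ! : ℂ)) • (N ^ j *ᵥ w))
      (∑ j ∈ Finset.range k, (c ^ j / (j ! : ℂ)) • (N ^ j *ᵥ w)) := by
    refine hasSum_sum_of_ne_finset_zero fun j hj => ?_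
    obtain ⟨i, rfl⟩ := Nat.exists_eq_add_of_le (not_lt.1 (Finset.mem_range.not.1 hj))
    rw [add_comm, pow_add N, ← Matrix.mulVec_mulVec, hw, Matrix.mulVec_zero, smul_zero]
  rw [h1, Matrix.smul_mulVec, h2.unique h4]

lemma tendsto_exp_mul_pow_atBot {z : ℂ} (hz : 0 < z.re) (j : ℕ) :
    Tendsto (fun s : ℝ => Complex.exp (s * z) * (s : ℂ) ^ j) atBot (𝓝 0) := by
  rw [tendsto_zero_iff_norm_tendsto_zero, ← tendsto_comp_neg_atTop_iff]
  have h := (tendsto_rpow_mul_exp_neg_mul_atTop_nhds_zero j z.re hz)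
  refine h.congr' ?_
  filter_upwards [eventually_gt_atTop 0] with s hs
  rw [norm_mul, Complex.norm_exp, norm_pow, Complex.norm_real, norm_neg, Real.norm_of_nonneg hs.le,
    Real.rpow_natCast, mul_comm]
  simp [mul_comm]

/-- If all eigenvalues of `A` have positive real part then `exp (s • A)` decays as `s → -∞`,
because this holds on each generalized eigenspace. -/
theorem tendsto_exp_smul_atBot (hA : ∀ z, Module.End.HasEigenvalue (Matrix.toLin' A) z → 0 < z.re) :
    Tendsto (fun s : ℝ => NormedSpace.exp ((s : ℂ) • A)) atBot (𝓝 0) := by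
  have key : ∀ w : Fin n → ℂ,
      Tendsto (fun s : ℝ => NormedSpace.exp ((s : ℂ) • A) *ᵥ w) atBot (𝓝 0) := by
    intro w
    have hw : w ∈ ⨆ z, Module.End.maxGenEigenspace (Matrix.toLin' A) z := by
      rw [Module.End.iSup_maxGenEigenspace_eq_top]; trivial
    induction hw using Submodule.iSup_induction' with
    | mem z w hw =>
      rcases eq_or_ne w 0 with rfl | hne
      · simp
      have hz : 0 < z.re := hA z <| Module.End.HasUnifEigenvalue.lt (k := ⊤) zero_lt_one
        (Module.End.HasUnifEigenvector.hasUnifEigenvalue ⟨hw, hne⟩)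
      obtain ⟨k, hk⟩ := (Module.End.mem_maxGenEigenspace _ _ _).1 hw
      have hk' : (A - z • 1) ^ k *ᵥ w = 0 := by
        rw [← Matrix.toLin'_apply, Matrix.toLin'_pow]
        simpa [Module.End.one_eq_id] using hk
      simp only [exp_smul_mulVec_of_pow_mulVec_eq_zero _ z hk', Finset.smul_sum, smul_smul]
      rw [← Finset.sum_const_zero (s := Finset.range k)]
      refine tendsto_finsetSum _ fun j _ => ?_
      have := ((tendsto_exp_mul_pow_atBot hz j).div_const (j ! : ℂ)).smul_const
        ((A - z • 1) ^ j *ᵥ w)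
      rw [zero_div, zero_smul] at this
      simpa only [mul_div_assoc] using this
    | zero => simp
    | add x y _ _ hx hy => simpa [Matrix.mulVec_add] using hx.add hy
  refine tendsto_pi_nhds.2 fun i => tendsto_pi_nhds.2 fun j => ?_
  simpa using (tendsto_pi_nhds.1 (key (Pi.single j 1))) i

variable {s : ℕ → ℝ} {A₀ : Matrix (Fin n) (Fin n) ℂ}

lemma tendsto_norm_exp_smul_mulVec
    (hA : Tendsto (fun k => NormedSpace.exp ((s k : ℂ) • A)) atTop (𝓝 A₀)) (w : Fin n → ℂ) :
    Tendsto (fun k => ‖NormedSpace.exp ((s k : ℂ) • A) *ᵥ w‖) atTop (𝓝 ‖A₀ *ᵥ w‖) :=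
  (((show Continuous fun M : Matrix (Fin n) (Fin n) ℂ => M *ᵥ w by fun_prop).norm).tendsto
    A₀).comp hA

lemma norm_exp_smul_mulVec_eigenvector {z : ℂ} {v : Fin n → ℂ}
    (hv : Module.End.HasEigenvector (Matrix.toLin' A) z v) (s : ℝ) :
    ‖NormedSpace.exp ((s : ℂ) • A) *ᵥ v‖ = Real.exp (s * z.re) * ‖v‖ := by
  have h : (A - z • 1) ^ 1 *ᵥ v = 0 := by
    have := hv.apply_eq_smul
    rw [Matrix.toLin'_apply] at this
    rw [pow_one, Matrix.sub_mulVec, this, Matrix.smul_mulVec, Matrix.one_mulVec, sub_self]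
  rw [exp_smul_mulVec_of_pow_mulVec_eq_zero _ z h, norm_smul, Complex.norm_exp]
  simp

lemma re_nonneg_of_tendsto_exp_smul (hs : Tendsto s atTop atBot)
    (hA : Tendsto (fun k => NormedSpace.exp ((s k : ℂ) • A)) atTop (𝓝 A₀)) {z : ℂ}
    (hz : Module.End.HasEigenvalue (Matrix.toLin' A) z) : 0 ≤ z.re := by
  by_contra! hneg
  obtain ⟨v, hv⟩ := hz.exists_hasEigenvector
  have h := tendsto_norm_exp_smul_mulVec hA v
  simp only [norm_exp_smul_mulVec_eigenvector hv] at h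
  refine not_tendsto_nhds_of_tendsto_atTop ?_ _ h
  exact (Real.tendsto_exp_atTop.comp (hs.atBot_mul_const_of_neg hneg)).atTop_mul_const
    (norm_pos_iff.2 hv.2)

lemma re_pos_of_tendsto_exp_smul_zero (hs : Tendsto s atTop atBot)
    (hA : Tendsto (fun k => NormedSpace.exp ((s k : ℂ) • A)) atTop (𝓝 0)) {z : ℂ}
    (hz : Module.End.HasEigenvalue (Matrix.toLin' A) z) : 0 < z.re := by
  refine (re_nonneg_of_tendsto_exp_smul hs hA hz).lt_of_ne fun h0 => ?_
  obtain ⟨v, hv⟩ := hz.exists_hasEigenvector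
  have h := tendsto_norm_exp_smul_mulVec hA v
  simp only [norm_exp_smul_mulVec_eigenvector hv, ← h0, mul_zero, Real.exp_zero, one_mul,
    Matrix.zero_mulVec, norm_zero] at h
  exact hv.2 (norm_eq_zero.1 (tendsto_nhds_unique tendsto_const_nhds h))

/-- A nontrivial Jordan block at a purely imaginary eigenvalue makes the exponential grow
linearly. -/
lemma rootMultiplicity_minpoly_eq_one_of_tendsto_exp_smul (hs : Tendsto s atTop atBot)
    (hA : Tendsto (fun k => NormedSpace.exp ((s k : ℂ) • A)) atTop (𝓝 A₀)) {z : ℂ}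
    (hz : Module.End.HasEigenvalue (Matrix.toLin' A) z) (hre : z.re = 0) :
    (minpoly ℂ A).rootMultiplicity z = 1 := by
  have hint : IsIntegral ℂ A := Algebra.IsIntegral.isIntegral A
  have hne : minpoly ℂ A ≠ 0 := minpoly.ne_zero hint
  have hroot : (minpoly ℂ A).IsRoot z := by
    have := Module.End.isRoot_of_hasEigenvalue hz
    rwa [Matrix.minpoly_toLin'] at this
  have h1 : 0 < (minpoly ℂ A).rootMultiplicity z :=
    (Polynomial.rootMultiplicity_pos hne).2 hroot
  by_contra hmult
  have h2 : (Polynomial.X - Polynomial.C z) ^ 2 ∣ minpoly ℂ A :=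
    (Polynomial.le_rootMultiplicity_iff hne).1 (by omega)
  obtain ⟨q, hq⟩ := h2
  have hX : Polynomial.aeval A (Polynomial.X - Polynomial.C z) = A - z • 1 := by
    simp [Algebra.algebraMap_eq_smul_one]
  set p := (Polynomial.X - Polynomial.C z) * q with hp
  have hpq : minpoly ℂ A = (Polynomial.X - Polynomial.C z) * p := by rw [hq, hp]; ring
  have hp0 : p ≠ 0 := fun h => hne (by rw [hpq, h, mul_zero])
  have hpA : Polynomial.aeval A p ≠ 0 := fun h => by
    have hd := Polynomial.natDegree_le_of_dvd (minpoly.dvd ℂ A h) hp0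
    rw [hpq, Polynomial.natDegree_mul (Polynomial.X_sub_C_ne_zero z) hp0,
      Polynomial.natDegree_X_sub_C] at hd
    omega
  obtain ⟨u, hu⟩ : ∃ u, Polynomial.aeval A p *ᵥ u ≠ 0 := by
    by_contra! h
    exact hpA (Matrix.ext_of_mulVec_single fun i => by rw [h, Matrix.zero_mulVec])
  set w := Polynomial.aeval A q *ᵥ u with hwdef
  have hw1 : (A - z • 1) *ᵥ w ≠ 0 := by
    rwa [hwdef, Matrix.mulVec_mulVec, ← hX, ← map_mul, ← hp]
  have hw2 : (A - z • 1) ^ 2 *ᵥ w = 0 := by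
    rw [hwdef, Matrix.mulVec_mulVec, ← hX, ← map_pow, ← map_mul, ← hq, minpoly.aeval,
      Matrix.zero_mulVec]
  have h := tendsto_norm_exp_smul_mulVec hA w
  refine not_tendsto_nhds_of_tendsto_atTop ?_ _ h
  have hinf : Tendsto (fun k => |s k| * ‖(A - z • 1) *ᵥ w‖ - ‖w‖) atTop atTop :=
    tendsto_atTop_add_const_right _ _
      ((tendsto_abs_atBot_atTop.comp hs).atTop_mul_const (norm_pos_iff.2 hw1))
  refine tendsto_atTop_mono (fun k => ?_) hinf
  rw [exp_smul_mulVec_of_pow_mulVec_eq_zero _ z hw2, norm_smul, Complex.norm_exp]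
  have e : ((s k : ℂ) * z).re = 0 := by simp [hre]
  rw [e, Real.exp_zero, one_mul]
  simp only [Finset.sum_range_succ, Finset.sum_range_zero, zero_add, pow_zero, pow_one,
    Matrix.one_mulVec, Nat.factorial_zero, Nat.factorial_one, Nat.cast_one, div_one, one_smul]
  have := norm_sub_norm_le ((s k : ℂ) • ((A - z • 1) *ᵥ w)) (-w)
  rwa [sub_neg_eq_add, norm_neg, norm_smul, Complex.norm_real, Real.norm_eq_abs, add_comm _ w]
    at this

end MatrixExponential

/-! ### Real matrices and their complexifications -/

section Complexification

open scoped Matrix.Norms.Operator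

variable {n : ℕ} {A : Matrix (Fin n) (Fin n) ℝ}

lemma complexify_exp_smul (s : ℝ) :
    complexify (NormedSpace.exp (s • A)) = NormedSpace.exp ((s : ℂ) • complexify A) := by
  have h := NormedSpace.map_exp (𝔸 := Matrix (Fin n) (Fin n) ℝ) (Complex.ofRealHom.mapMatrix)
    (Continuous.matrix_map continuous_id Complex.continuous_ofReal) (s • A)
  refine h.trans ?_
  congr 1
  ext i j
  simp [complexify]

lemma toEuclideanCLM_exp_smul (s : ℝ) :
    Matrix.toEuclideanCLM (n := Fin n) (𝕜 := ℝ) (NormedSpace.exp (s • A)) =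
      NormedSpace.exp (s • Matrix.toEuclideanCLM (n := Fin n) (𝕜 := ℝ) A) := by
  have hc : Continuous (Matrix.toEuclideanCLM (n := Fin n) (𝕜 := ℝ)) :=
    LinearMap.continuous_of_finiteDimensional
      (Matrix.toEuclideanCLM (n := Fin n) (𝕜 := ℝ)).toAlgEquiv.toLinearMap
  refine (NormedSpace.map_exp (𝔸 := Matrix (Fin n) (Fin n) ℝ) _ hc (s • A)).trans ?_
  rw [map_smul]

/-- Convergence of real operator exponentials passes to the complexified matrices. -/
lemma tendsto_complexify_exp_smul {s : ℕ → ℝ}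
    {L : EuclideanSpace ℝ (Fin n) →L[ℝ] EuclideanSpace ℝ (Fin n)}
    (h : Tendsto (fun k => NormedSpace.exp (s k • Matrix.toEuclideanCLM (n := Fin n) (𝕜 := ℝ) A))
      atTop (𝓝 L)) :
    Tendsto (fun k => NormedSpace.exp ((s k : ℂ) • complexify A)) atTop
      (𝓝 (complexify ((Matrix.toEuclideanCLM (n := Fin n) (𝕜 := ℝ)).symm L))) := by
  have hc : Continuous (Matrix.toEuclideanCLM (n := Fin n) (𝕜 := ℝ)).symm :=
    LinearMap.continuous_of_finiteDimensional
      (Matrix.toEuclideanCLM (n := Fin n) (𝕜 := ℝ)).symm.toAlgEquiv.toLinearMap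
  have hmap : Continuous (complexify (n := n)) :=
    Continuous.matrix_map continuous_id Complex.continuous_ofReal
  refine ((hmap.comp hc).tendsto L |>.comp h).congr fun k => ?_
  rw [Function.comp_apply, ← toEuclideanCLM_exp_smul, Function.comp_apply,
    StarAlgEquiv.symm_apply_apply, complexify_exp_smul]

lemma mem_classM_of_tendsto_exp_smul {s : ℕ → ℝ} (hs : Tendsto s atTop atBot)
    {L : EuclideanSpace ℝ (Fin n) →L[ℝ] EuclideanSpace ℝ (Fin n)}
    (h : Tendsto (fun k => NormedSpace.exp (s k • Matrix.toEuclideanCLM (n := Fin n) (𝕜 := ℝ) A))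
      atTop (𝓝 L)) : A ∈ classM n :=
  ⟨fun _ hz => re_nonneg_of_tendsto_exp_smul hs (tendsto_complexify_exp_smul h) hz,
    fun _ hz hre => rootMultiplicity_minpoly_eq_one_of_tendsto_exp_smul hs
      (tendsto_complexify_exp_smul h) hz hre⟩

lemma mem_classQ_of_tendsto_exp_smul {s : ℕ → ℝ} (hs : Tendsto s atTop atBot)
    (h : Tendsto (fun k => NormedSpace.exp (s k • Matrix.toEuclideanCLM (n := Fin n) (𝕜 := ℝ) A))
      atTop (𝓝 0)) : A ∈ classQ n := by
  have h' := tendsto_complexify_exp_smul h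
  have h0 : complexify (0 : Matrix (Fin n) (Fin n) ℝ) = 0 := by ext i j; simp [complexify]
  rw [map_zero, h0] at h'
  have hre : ∀ z : ℂ, IsComplexEigenvalue A z → 0 < z.re := fun z hz =>
    re_pos_of_tendsto_exp_smul_zero hs h' hz
  refine ⟨?_, hre⟩
  -- a singular matrix has the eigenvalue zero
  by_contra hA
  have hdet : (complexify A).det = 0 := by
    have h1 : (complexify A).det = (A.det : ℂ) := (Complex.ofRealHom.map_det A).symm
    rw [Matrix.isUnit_iff_isUnit_det, isUnit_iff_ne_zero, not_not] at hA
    rw [h1, hA, Complex.ofReal_zero]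
  obtain ⟨v, hv, hv0⟩ := Matrix.exists_mulVec_eq_zero_iff.2 hdet
  refine lt_irrefl (0 : ℝ) (hre 0 ?_)
  exact Module.End.hasEigenvalue_of_hasEigenvector (x := v)
    ⟨Module.End.mem_eigenspace_iff.2 (by rw [Matrix.toLin'_apply, hv0, zero_smul]), hv⟩

lemma tendsto_exp_smul_atBot_of_mem_classQ (hA : A ∈ classQ n) :
    Tendsto (fun s : ℝ => NormedSpace.exp (s • Matrix.toEuclideanCLM (n := Fin n) (𝕜 := ℝ) A))
      atBot (𝓝 0) := by
  have h := tendsto_exp_smul_atBot (A := complexify A) hA.2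
  have hre : Continuous fun M : Matrix (Fin n) (Fin n) ℂ => M.map Complex.re :=
    Continuous.matrix_map continuous_id Complex.continuous_re
  have hc : Continuous (Matrix.toEuclideanCLM (n := Fin n) (𝕜 := ℝ)) :=
    LinearMap.continuous_of_finiteDimensional
      (Matrix.toEuclideanCLM (n := Fin n) (𝕜 := ℝ)).toAlgEquiv.toLinearMap
  have h0 : (0 : Matrix (Fin n) (Fin n) ℂ).map Complex.re = 0 := by ext i j; simp
  have := ((hc.comp hre).tendsto 0).comp h
  rw [Function.comp_apply, h0, map_zero] at this
  refine this.congr fun s => ?_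
  have e : (complexify (NormedSpace.exp (s • A))).map Complex.re = NormedSpace.exp (s • A) := by
    ext i j; simp [complexify]
  rw [Function.comp_apply, Function.comp_apply, ← complexify_exp_smul, e, toEuclideanCLM_exp_smul]

end Complexification

/-! ### Operator-self-similar random fields -/

section OperatorSelfSimilarity

lemma tendsto_nhdsWithin_of_forall_seq {α β : Type*} [TopologicalSpace α]
    [FirstCountableTopology α] {f : α → β} {S : Set α} {x : α} {l : Filter β}
    (h : ∀ u : ℕ → α, (∀ n, u n ∈ S) → Tendsto u atTop (𝓝 x) → Tendsto (f ∘ u) atTop l) :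
    Tendsto f (𝓝[S] x) l := by
  refine tendsto_of_seq_tendsto fun u hu => ?_
  obtain ⟨hux, huS⟩ := tendsto_nhdsWithin_iff.1 hu
  obtain ⟨N, hN⟩ := eventually_atTop.1 huS
  refine (tendsto_add_atTop_iff_nat N).1 ?_
  exact h (fun n => u (n + N)) (fun n => hN _ (Nat.le_add_left N n))
    (hux.comp (tendsto_add_atTop_nat N))

variable {d m : ℕ} {Ω : Type*} [MeasurableSpace Ω] {P : Measure Ω}
  {X : EuclideanSpace ℝ (Fin d) → Ω → EuclideanSpace ℝ (Fin m)}
  {E : Matrix (Fin d) (Fin d) ℝ}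

lemma tendsto_clm_apply {ι U V : Type*} [NormedAddCommGroup U] [NormedSpace ℝ U]
    [NormedAddCommGroup V] [NormedSpace ℝ V] {l : Filter ι} {A : ι → U →L[ℝ] V} {A₀ : U →L[ℝ] V}
    {u : ι → U} {u₀ : U} (hA : Tendsto A l (𝓝 A₀)) (hu : Tendsto u l (𝓝 u₀)) :
    Tendsto (fun n => A n (u n)) l (𝓝 (A₀ u₀)) :=
  (isBoundedBilinearMap_apply.continuous.tendsto (A₀, u₀)).comp (hA.prodMk_nhds hu)

lemma matAct_opPow {n : ℕ} (r : ℝ) (A : Matrix (Fin n) (Fin n) ℝ) (x : EuclideanSpace ℝ (Fin n)) :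
    matAct (opPow r A) x =
      NormedSpace.exp (Real.log r • Matrix.toEuclideanCLM (n := Fin n) (𝕜 := ℝ) A) x := by
  rw [matAct, opPow, toEuclideanCLM_exp_smul]

lemma nonempty_scalingSet (hwoss : IsWOSS P X E) (s : ℝ) :
    (scalingSet P X (Matrix.toEuclideanCLM (n := Fin d) (𝕜 := ℝ) E) s).Nonempty := by
  obtain ⟨B, a, h⟩ := hwoss (Real.exp s) (Real.exp_pos s)
  refine ⟨Matrix.toEuclideanCLM (n := Fin m) (𝕜 := ℝ) B, a, ?_⟩
  simp only [ScalesBy, matAct_opPow, Real.log_exp] at h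
  exact h

variable [IsProbabilityMeasure P] {D : Matrix (Fin m) (Fin m) ℝ}
  (hX : ∀ t, Measurable (X t))
  (hD : ∀ s : ℝ, NormedSpace.exp (s • Matrix.toEuclideanCLM (n := Fin m) (𝕜 := ℝ) D) ∈
    scalingSet P X (Matrix.toEuclideanCLM (n := Fin d) (𝕜 := ℝ) E) s)

include hX hD

/-- As `s → -∞` the times `exp (s • E) t` contract to the origin, which prevents
`exp (s • D)` from blowing up. -/
lemma exists_tendsto_exp_smul_exponent [Nonempty (Fin d)] (hcont : StochasticallyContinuous P X)
    (hproper : IsProperField P X) (hE : E ∈ classQ d) :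
    ∃ s : ℕ → ℝ, Tendsto s atTop atBot ∧ ∃ L,
      Tendsto (fun k => NormedSpace.exp (s k • Matrix.toEuclideanCLM (n := Fin m) (𝕜 := ℝ) D))
        atTop (𝓝 L) ∧
      ((∃ a, ∀ᵐ ω ∂P, X 0 ω = a) → L = 0) := by
  obtain ⟨t, ht⟩ := exists_ne (0 : EuclideanSpace ℝ (Fin d))
  have hfull : ∀ t, t ≠ 0 → IsLinearlyFull (P.prod P) (symmetrize (X t)) := fun t ht =>
    (hproper t ht).isLinearlyFull_symmetrize (hX t)
  have hs : Tendsto (fun k : ℕ => -(k : ℝ)) atTop atBot :=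
    tendsto_neg_atTop_atBot.comp tendsto_natCast_atTop_atTop
  have hexp : Tendsto (fun k : ℕ => NormedSpace.exp
      (-(k : ℝ) • Matrix.toEuclideanCLM (n := Fin d) (𝕜 := ℝ) E) t) atTop (𝓝 0) := by
    have h := (tendsto_exp_smul_atBot_of_mem_classQ hE).comp hs
    have h' := tendsto_clm_apply h (tendsto_const_nhds (x := t))
    rwa [zero_apply] at h'
  obtain ⟨L, φ, hφ, hL, hid⟩ := exists_subseq_tendsto_of_mem_scalingSet hX hcont hfull ht
    (fun k : ℕ => hD (-(k : ℝ))) hexp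
  refine ⟨fun k => -(φ k : ℝ), hs.comp hφ.tendsto_atTop, L, hL, fun ⟨a, ha⟩ => ?_⟩
  refine (hfull t ht).clm_eq_zero ?_
  exact hid.ae_snd (p := fun x => x = 0) (measurableSet_singleton 0) (symmetrize_ae_eq_zero ha)

/-- If `exp (s • D)` decays as `s → -∞`, then the self-similarity relation at the fixed point
`t = 0` makes the symmetrization of `X 0` vanish. -/
lemma exists_ae_eq_const_of_mem_classQ (hDQ : D ∈ classQ m) : ∃ a, ∀ᵐ ω ∂P, X 0 ω = a := by
  have hs : Tendsto (fun k : ℕ => -(k : ℝ)) atTop atBot :=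
    tendsto_neg_atTop_atBot.comp tendsto_natCast_atTop_atTop
  have hlim := (tendsto_exp_smul_atBot_of_mem_classQ hDQ).comp hs
  have hconst : TendstoInMeasure (P.prod P) (fun _ : ℕ => symmetrize (X 0)) atTop
      (symmetrize (X 0)) := fun ε hε => by simp [hε.ne']
  have hm := (measurable_symmetrize (hX 0)).aestronglyMeasurable (μ := P.prod P)
  have hid := identDistrib_of_tendstoInMeasure hconst
    (tendstoInMeasure_continuous_comp_param
      (g := fun (B : EuclideanSpace ℝ (Fin m) →L[ℝ] EuclideanSpace ℝ (Fin m)) x => B x)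
      (by fun_prop) hlim (fun _ => hm) hconst) fun k => by
        obtain ⟨a, ha⟩ := hD (-(k : ℝ))
        have h0 := ha.identDistrib 0
        rw [map_zero] at h0
        exact identDistrib_symmetrize_of_add (hX 0) (hX 0) h0
  exact exists_ae_eq_const_of_symmetrize (ae_eq_of_identDistrib_const hid)

end OperatorSelfSimilarity

theorem mainTheorem1 {d m : ℕ} (hd : 2 ≤ d) (hm : 2 ≤ m)
    {Ω : Type*} [MeasurableSpace Ω] (P : Measure Ω) [IsProbabilityMeasure P]
    (X : EuclideanSpace ℝ (Fin d) → Ω → EuclideanSpace ℝ (Fin m))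
    (hX : ∀ t, Measurable (X t))
    (hcont : StochasticallyContinuous P X)
    (hproper : IsProperField P X)
    (E : Matrix (Fin d) (Fin d) ℝ) (hE : E ∈ classQ d)
    (hwoss : IsWOSS P X E) :
    ∃ D ∈ classM m, ∃ b : ℝ → EuclideanSpace ℝ (Fin d) → EuclideanSpace ℝ (Fin m),
      ContinuousOn (fun p : ℝ × EuclideanSpace ℝ (Fin d) => b p.1 p.2)
        (Set.Ioi 0 ×ˢ Set.univ) ∧
      (∀ r : ℝ, 0 < r → ScalesBy P X E r (opPow r D) (b r)) ∧
      ((∃ a : EuclideanSpace ℝ (Fin m), ∀ᵐ ω ∂P, X 0 ω = a) ↔ D ∈ classQ m) ∧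
      (∀ a : EuclideanSpace ℝ (Fin m), (∀ᵐ ω ∂P, X 0 ω = a) →
        ContinuousOn
          (fun p : ℝ × EuclideanSpace ℝ (Fin d) => if p.1 = 0 then a else b p.1 p.2)
          (Set.Ici 0 ×ˢ Set.univ)) := by
  have : Nonempty (Fin d) := ⟨⟨0, by omega⟩⟩
  have : Nonempty (Fin m) := ⟨⟨0, by omega⟩⟩
  have hfull : ∀ t, t ≠ 0 → IsLinearlyFull (P.prod P) (symmetrize (X t)) := fun t ht =>
    (hproper t ht).isLinearlyFull_symmetrize (hX t)
  set F := Matrix.toEuclideanCLM (n := Fin d) (𝕜 := ℝ) E with hF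
  obtain ⟨L, hL⟩ := (isProperFibration_scalingSet hX hcont hfull
    (nonempty_scalingSet hwoss)).exists_forall_exp_smul_mem
  obtain ⟨D, rfl⟩ := (Matrix.toEuclideanCLM (n := Fin m) (𝕜 := ℝ)).surjective L
  obtain ⟨s, hs, L₀, hL₀, hconst⟩ := exists_tendsto_exp_smul_exponent hX hL hcont hproper hE
  have hQ : (∃ a, ∀ᵐ ω ∂P, X 0 ω = a) → D ∈ classQ m := fun h => by
    rw [hconst h] at hL₀
    exact mem_classQ_of_tendsto_exp_smul hs hL₀
  choose a ha using hL
  -- the shifts converge as `(r, t)` tends to a point with `r > 0`, or with `r = 0` when `D ∈ Q`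
  have hpos : ContinuousOn (fun p : ℝ × EuclideanSpace ℝ (Fin d) => a (Real.log p.1) p.2)
      (Set.Ioi 0 ×ˢ Set.univ) := by
    rintro ⟨r, t⟩ ⟨hr, -⟩
    refine tendsto_nhdsWithin_of_forall_seq fun u _ hux => ?_
    have hlog : Tendsto (fun n => Real.log (u n).1) atTop (𝓝 (Real.log r)) :=
      (Real.continuousAt_log (ne_of_gt hr)).tendsto.comp hux.fst_nhds
    refine tendsto_shift hX hcont (F := F) hux.snd_nhds
      (((continuous_exp_smul _).tendsto _).comp hlog)
      (tendsto_clm_apply (((continuous_exp_smul F).tendsto _).comp hlog) hux.snd_nhds)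
      (fun n => (ha _).identDistrib _) ((ha _).identDistrib t)
  have hzero : ∀ a₀, (∀ᵐ ω ∂P, X 0 ω = a₀) → ∀ t,
      Tendsto (fun p : ℝ × EuclideanSpace ℝ (Fin d) => a (Real.log p.1) p.2)
        (𝓝[Set.Ioi 0 ×ˢ Set.univ] (0, t)) (𝓝 a₀) := by
    intro a₀ ha₀ t
    refine tendsto_nhdsWithin_of_forall_seq fun u hu hux => ?_
    have hlog : Tendsto (fun n => Real.log (u n).1) atTop atBot :=
      Real.tendsto_log_nhdsGT_zero.comp
        (tendsto_nhdsWithin_iff.2 ⟨hux.fst_nhds, Eventually.of_forall fun n => (hu n).1⟩)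
    have hF0 : Tendsto (fun n => NormedSpace.exp (Real.log (u n).1 • F) (u n).2) atTop (𝓝 0) := by
      have h := tendsto_clm_apply ((tendsto_exp_smul_atBot_of_mem_classQ hE).comp hlog) hux.snd_nhds
      rwa [zero_apply] at h
    refine tendsto_shift hX hcont (F := F) hux.snd_nhds
      ((tendsto_exp_smul_atBot_of_mem_classQ (hQ ⟨a₀, ha₀⟩)).comp hlog) hF0
      (fun n => (ha _).identDistrib _) ?_
    -- the limiting relation `X 0 = 0 * X t + a₀` holds almost surely
    refine IdentDistrib.of_ae_eq (hX 0).aemeasurable ?_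
    filter_upwards [ha₀] with ω hω
    simp [hω]
  refine ⟨D, mem_classM_of_tendsto_exp_smul hs hL₀, fun r => a (Real.log r), hpos, ?_,
    ⟨hQ, exists_ae_eq_const_of_mem_classQ hX fun s => ⟨a s, ha s⟩⟩, ?_⟩
  · intro r _
    simp only [ScalesBy, matAct_opPow]
    exact ha (Real.log r)
  · rintro a₀ ha₀ ⟨r, t⟩ ⟨hr, -⟩
    rcases (Set.mem_Ici.1 hr).eq_or_lt with hr0 | hr0
    · dsimp only at hr0
      subst hr0
      -- on `{0} × ℝᵈ` the function is constant, so only the approach from `r > 0` matters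
      have hunion : (Set.Ici (0 : ℝ) ×ˢ Set.univ : Set (ℝ × EuclideanSpace ℝ (Fin d))) =
          {0} ×ˢ Set.univ ∪ Set.Ioi 0 ×ˢ Set.univ := by
        rw [← Set.union_prod, Set.singleton_union, Set.Ioi_insert]
      rw [hunion, continuousWithinAt_union]
      constructor
      · refine (continuousWithinAt_const (b := a₀)).congr (fun p hp => ?_) (by simp)
        exact if_pos hp.1
      · rw [ContinuousWithinAt, if_pos rfl]
        refine (hzero a₀ ha₀ t).congr' ?_
        filter_upwards [self_mem_nhdsWithin] with p hp
        exact (if_neg (ne_of_gt hp.1)).symm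
    · have hnhds : Set.Ioi (0 : ℝ) ×ˢ Set.univ ∈ 𝓝 (r, t) :=
        (isOpen_Ioi.prod isOpen_univ).mem_nhds ⟨hr0, trivial⟩
      refine ContinuousAt.continuousWithinAt ?_
      refine (hpos.continuousAt hnhds).congr ?_
      filter_upwards [hnhds] with p hp
      exact (if_neg (ne_of_gt hp.1)).symm
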